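/- Theorem 2.1. Let $n\ge 1$, let $F:\mathbb R^m\to\mathbb R$ be smooth, $\vec f=(f_1,\dots,f_m)=\nabla F$, $x_0\in\mathbb R^n$, $\delta>0$, and write $B_r=\{x\in\mathbb R^n:|x-x_0|<r\}$, with outer unit normal $\nu$ on $\partial B_r$. Let $\vec u=(u_1,\dots,u_m)\in H^1_{loc}(B_\delta;\mathbb R^m)$ be a variational solution of $\Delta u_i+f_i(\vec u)=0$ $(i=1,\dots,m)$ in $B_\delta$; that is, (i) $f_i(\vec u)$, $u_if_i(\vec u)$ and $F(\vec u)$ belong to $L^1_{loc}(B_\delta)$ for every $i$; (ii) $\int_{B_\delta}\big(u_i\,\Delta\varphi+f_i(\vec u)\,\varphi\big)=0$ for every $i$ and every $\varphi\in C_c^\infty(B_\delta)$; (iii) $\int_{B_\delta}\big[(|\nabla\vec u|^2-2F(\vec u))\,\mathrm{div}\,\phi-2\sum_{i=1}^m\nabla u_i\cdot D\phi\,\nabla u_i\big]=0$ for every $\phi\in C^1_c(B_\delta;\mathbb R^n)$, where $D\phi=(\partial_k\phi_j)_{jk}$. Let $\beta\in\mathbb R$ be such that $$\int_{B_r}\big(2(\beta-1)F(\vec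 u)-\beta\,\vec u\cdot\vec f(\vec u)\big)\ \ge\ 0\qquad\text{for all }0<r<\delta .$$ For $0<r<\delta$ put $$\Phi_{x_0}(r)=r^{-n-2\beta+2}\int_{B_r}\big(|\nabla\vec u|^2-2F(\vec u)\big)-\beta\, r^{-n-2\beta+1}\int_{\partial B_r}|\vec u|^2\,d\mathcal H^{n-1},$$ where the values of $\vec u$ on $\partial B_r$ are those of its Sobolev trace. Then the traces, and all volume integrals involved, exist for every $0<r<\delta$; the inner boundary integral below exists for almost every such $r$; and for all $0<\rho<\sigma<\delta$ both integrals over $(\rho,\sigma)$ below converge, and $$\Phi_{x_0}(\sigma)-\Phi_{x_0}(\rho)=\int_\rho^\sigma 2r^{-n-2\beta+1}\int_{B_r}\big(2(\beta-1)F(\vec u)-\beta\,\vec u\cdot\vec f(\vec u)\big)\,dx\,dr+\int_\rho^\sigma 2r^{-n-2\beta+2}\int_{\partial B_r}\sum_{i=1}^m\Big(\nabla u_i\cdot\nu-\beta\frac{u_i}{r}\Big)^2d\mathcal H^{n-1}\,dr\ \ge\ 0 .$$ In particular, $\Phi_{x_0}$ is nondecreasing on $(0,\delta)$. -/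

import Mathlib

open MeasureTheory Metric Set
open scoped ContDiff

namespace BoundaryAdjustedEnergy

noncomputable section

/-- Euclidean space of dimension `k`, with its Euclidean norm and Lebesgue measure. -/
abbrev Euc (k : ℕ) : Type := EuclideanSpace ℝ (Fin k)

/-- `v` belongs to `L²_loc(Ω)`. -/
def MemL2Loc {n : ℕ} {X : Type*} [NormedAddCommGroup X]
    (Ω : Set (Euc n)) (v : Euc n → X) : Prop :=
  ∀ K : Set (Euc n), K ⊆ Ω → IsCompact K → MemLp v 2 (volume.restrict K)

/-- `g` is a weak (distributional) gradient of the scalar function `v` on `Ω`: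
`∫_Ω v ∂_e φ = - ∫_Ω (g ⬝ e) φ` for all `φ ∈ C_c^∞(Ω)` and all directions `e`. -/
structure IsWeakGradient {n : ℕ} (Ω : Set (Euc n)) (v : Euc n → ℝ) (g : Euc n → Euc n) :
    Prop where
  locallyIntegrable : LocallyIntegrableOn v Ω
  locallyIntegrable_grad : LocallyIntegrableOn g Ω
  integral_eq : ∀ φ : Euc n → ℝ, ContDiff ℝ ∞ φ → HasCompactSupport φ → tsupport φ ⊆ Ω →
    ∀ e : Euc n, ∫ x in Ω, v x * fderiv ℝ φ x e = -∫ x in Ω, inner ℝ (g x) e * φ x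

/-- `v ∈ H¹_loc(Ω)`, with weak gradient `g`. -/
structure IsH1Loc {n : ℕ} (Ω : Set (Euc n)) (v : Euc n → ℝ) (g : Euc n → Euc n) : Prop where
  weakGradient : IsWeakGradient Ω v g
  memL2Loc : MemL2Loc Ω v
  memL2Loc_grad : MemL2Loc Ω g

/-- The divergence of a vector field. -/
def divergence {n : ℕ} (φ : Euc n → Euc n) (x : Euc n) : ℝ :=
  ∑ j : Fin n, (fderiv ℝ φ x (EuclideanSpace.single j 1)) j

/-- `|∇u|² = ∑ᵢ |∇uᵢ|²`, where `Du i` is the gradient of the `i`-th component. -/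
def gradSq {n m : ℕ} (Du : Fin m → Euc n → Euc n) (x : Euc n) : ℝ :=
  ∑ i : Fin m, ‖Du i x‖ ^ 2

/-- `u = (u₁, …, u_m)`, with weak gradients `Du i` of the components, is a variational solution of
`Δ uᵢ + fᵢ(u) = 0` in `Ω`, where `f = ∇F`: it lies in `H¹_loc(Ω)`, solves the system in the sense
of distributions, and is stationary under domain variations for `∫ (|∇u|² - 2 F(u))`.
The expression `∇uᵢ Dφ ∇uᵢ` is `∑_{j,k} ∂_j uᵢ (∂_k φ_j) ∂_k uᵢ`. -/
structure IsVariationalSolution {n m : ℕ} (F : Euc m → ℝ) (Ω : Set (Euc n))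
    (u : Euc n → Euc m) (Du : Fin m → Euc n → Euc n) : Prop where
  h1Loc : ∀ i, IsH1Loc Ω (fun x => u x i) (Du i)
  locallyIntegrable_f : ∀ i, LocallyIntegrableOn (fun x => gradient F (u x) i) Ω
  locallyIntegrable_mul_f : ∀ i, LocallyIntegrableOn (fun x => u x i * gradient F (u x) i) Ω
  locallyIntegrable_F : LocallyIntegrableOn (fun x => F (u x)) Ω
  distributional : ∀ i, ∀ φ : Euc n → ℝ,
    ContDiff ℝ ∞ φ → HasCompactSupport φ → tsupport φ ⊆ Ω →
    ∫ x in Ω, (u x i * Laplacian.laplacian φ x + gradient F (u x) i * φ x) = 0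
  stationary : ∀ φ : Euc n → Euc n,
    ContDiff ℝ 1 φ → HasCompactSupport φ → tsupport φ ⊆ Ω →
    ∫ x in Ω, ((gradSq Du x - 2 * F (u x)) * divergence φ x
      - 2 * ∑ i, inner ℝ (Du i x) (fderiv ℝ φ x (Du i x))) = 0

/-- The surface measure `ℋ^{n-1}` (normalized Hausdorff measure) of the sphere `∂B_r(x₀)`, as a
measure on the ambient space (`n ≥ 1`, `r > 0`): the surface measure of the unit sphere,
transported by `y ↦ x₀ + r y` and multiplied by `r^{n-1}`. -/
def sphereMeasure {n : ℕ} (x₀ : Euc n) (r : ℝ) : Measure (Euc n) :=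
  ENNReal.ofReal (r ^ (n - 1)) •
    Measure.map (fun y : sphere (0 : Euc n) 1 => x₀ + r • (y : Euc n))
      (Measure.toSphere (volume : Measure (Euc n)))

/-- The outer unit normal of `∂B_r(x₀)`. -/
def sphereNormal {n : ℕ} (x₀ : Euc n) (r : ℝ) (x : Euc n) : Euc n := r⁻¹ • (x - x₀)

/-- `T` is the trace on `∂B_r(x₀)` of the Sobolev function `v` with weak gradient `g`: it is the
(unique up to null sets) function in `L²(∂B_r(x₀))` for which the Gauss–Green formula
`∫_{B_r} (v div φ + ∇v ⬝ φ) = ∫_{∂B_r} T φ ⬝ ν dℋ^{n-1}` holds for all smooth `φ`. -/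
structure IsSphereTrace {n : ℕ} (x₀ : Euc n) (r : ℝ) (v : Euc n → ℝ) (g : Euc n → Euc n)
    (T : Euc n → ℝ) : Prop where
  memLp : MemLp T 2 (sphereMeasure x₀ r)
  gaussGreen : ∀ φ : Euc n → Euc n, ContDiff ℝ ∞ φ →
    ∫ x in ball x₀ r, (v x * divergence φ x + inner ℝ (g x) (φ x))
      = ∫ x, T x * inner ℝ (φ x) (sphereNormal x₀ r x) ∂(sphereMeasure x₀ r)

/-- `∫_{B_r(x₀)} (2(β-1) F(u) - β u ⬝ f(u))`, with `f = ∇F`. -/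
def bulkTerm {n m : ℕ} (F : Euc m → ℝ) (β : ℝ) (x₀ : Euc n) (u : Euc n → Euc m) (r : ℝ) : ℝ :=
  ∫ x in ball x₀ r, (2 * (β - 1) * F (u x) - β * inner ℝ (u x) (gradient F (u x)))

/-- The integrand `(∇u ⬝ ν - β u / r)² = ∑ᵢ (∇uᵢ ⬝ ν - β uᵢ / r)²` on `∂B_r(x₀)`; here `T` stands
for the boundary values of `u` on `∂B_r(x₀)`. -/
def boundaryIntegrand {n m : ℕ} (β : ℝ) (x₀ : Euc n) (Du : Fin m → Euc n → Euc n)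
    (T : Euc n → Euc m) (r : ℝ) (x : Euc n) : ℝ :=
  ∑ i : Fin m, (inner ℝ (Du i x) (sphereNormal x₀ r x) - β * T x i / r) ^ 2

/-- The boundary-adjusted energy
`Φ(r) = r^{-n-2β+2} ∫_{B_r} (|∇u|² - 2F(u)) - β r^{-n-2β+1} ∫_{∂B_r} |u|² dℋ^{n-1}`, where `T r`
stands for the boundary values of `u` on `∂B_r(x₀)`. -/
def boundaryAdjustedEnergy {n m : ℕ} (F : Euc m → ℝ) (β : ℝ) (x₀ : Euc n) (u : Euc n → Euc m)
    (Du : Fin m → Euc n → Euc n) (T : ℝ → Euc n → Euc m) (r : ℝ) : ℝ :=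
  r ^ (-(n : ℝ) - 2 * β + 2) * (∫ x in ball x₀ r, (gradSq Du x - 2 * F (u x)))
    - β * r ^ (-(n : ℝ) - 2 * β + 1) * ∫ x, ‖T r x‖ ^ 2 ∂(sphereMeasure x₀ r)

end

end BoundaryAdjustedEnergy

open BoundaryAdjustedEnergy

namespace BoundaryAdjustedEnergy

open Filter Topology Measure
open scoped Convolution

variable {n m : ℕ}

/-! The idea is to differentiate the energy in `r`, eliminate the unwanted terms by two integral
identities on spheres, and recognise a complete square. Write p = -n - 2β, D(r) = ∫_{B_r} (|∇u|² -
2F(u)), and K(r) = r ∫_{∂B_r} |u|². The divergence theorem for the fields uᵢ² (x - x₀) gives K(r) =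
∫_{B_r} Σ (n uᵢ² + 2 uᵢ ∇uᵢ·(x - x₀)), so Φ(r) = r^(p+2) D(r) - β r^p K(r) involves volume integrals
only. In polar coordinates these are primitives of integrals over spheres, hence Φ is absolutely
continuous on compact subintervals of (0,δ).

Two identities hold for almost every r. Stationarity tested with η(|x - x₀|)(x - x₀) gives the
Pohozaev identity r (∫_{∂B_r} (|∇u|² - 2F) - 2 ∫_{∂B_r} |∂_ν u|²) = n D - 2 ∫_{B_r} |∇u|²
(`ae_pohozaev_identity`). The equation tested with η u gives ∫_{∂B_r} u·∂_ν u = ∫_{B_r} (|∇u|² -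
u·f) (`IsH1Loc.ae_energy_identity`). Inserting both into Φ' leaves twice the weighted bulk term plus
twice the weighted integral of |∂_ν u - βu/r|². Both are nonnegative, the first by assumption.

Low regularity requires three devices. Radial profiles yield identities on almost every sphere
through the fundamental lemma of the calculus of variations (`ae_integral_sphere_eq_integral_ball`).
Since u may be unbounded and f(u) is only locally integrable, η u is replaced by η j sin(w/j) with w
a mollification of a component; mollification is removed first, then j → ∞
(`IsH1Loc.integral_truncated`). Traces on every sphere are L² limits of mollifications, and on
almost every sphere they agree with u itself (`IsH1Loc.ae_trace_eq`). -/

/-! ### Polar coordinates -/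

/-- Polar coordinates centred at `x₀`. -/
noncomputable def polarMap (x₀ : Euc n) (p : sphere (0 : Euc n) 1 × Ioi (0 : ℝ)) : Euc n :=
  x₀ + p.2.1 • p.1.1

theorem polarMap_eq (x₀ : Euc n) :
    polarMap x₀ = (fun x => x₀ + x) ∘ (Subtype.val ∘ (homeomorphUnitSphereProd (Euc n)).symm) := by
  ext1 p
  simp [polarMap]

theorem measurableEmbedding_polarMap (x₀ : Euc n) : MeasurableEmbedding (polarMap x₀) := by
  rw [polarMap_eq]
  exact (measurableEmbedding_addLeft x₀).comp
    ((MeasurableEmbedding.subtype_coe (measurableSet_singleton _).compl).comp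
      (Homeomorph.measurableEmbedding _))

/-- Polar coordinates omit the centre; in dimension at least one this is a null set. -/
theorem measurePreserving_polarMap [NeZero n] (x₀ : Euc n) :
    MeasurePreserving (polarMap x₀)
      ((volume : Measure (Euc n)).toSphere.prod (volumeIoiPow (n - 1))) volume := by
  rw [polarMap_eq]
  have h1 : MeasurePreserving (homeomorphUnitSphereProd (Euc n)).symm
      ((volume : Measure (Euc n)).toSphere.prod (volumeIoiPow (n - 1)))
      ((volume : Measure (Euc n)).comap (↑)) := by
    have h := (volume : Measure (Euc n)).measurePreserving_homeomorphUnitSphereProd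
    rw [finrank_euclideanSpace_fin] at h
    exact h.symm (homeomorphUnitSphereProd (Euc n)).toMeasurableEquiv
  have h2 : MeasurePreserving (Subtype.val : ({0}ᶜ : Set (Euc n)) → Euc n)
      ((volume : Measure (Euc n)).comap (↑)) volume := by
    refine ⟨measurable_subtype_coe, ?_⟩
    rw [map_comap_subtype_coe (measurableSet_singleton _).compl, restrict_compl_singleton]
  exact (measurePreserving_add_left volume x₀).comp (h2.comp h1)

theorem measurableEmbedding_sphere (x₀ : Euc n) {s : ℝ} (hs : 0 < s) :
    MeasurableEmbedding (fun y : sphere (0 : Euc n) 1 => x₀ + s • (y : Euc n)) :=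
  (measurableEmbedding_addLeft x₀).comp
    ((measurableEmbedding_const_smul₀ hs.ne').comp
      (MeasurableEmbedding.subtype_coe isClosed_sphere.measurableSet))

instance isFiniteMeasure_sphereMeasure (x₀ : Euc n) (s : ℝ) :
    IsFiniteMeasure (sphereMeasure x₀ s) := by
  unfold sphereMeasure
  exact Measure.smul_finite _ ENNReal.ofReal_ne_top

theorem integrable_sphereMeasure_iff {E : Type*} [NormedAddCommGroup E]
    (x₀ : Euc n) {s : ℝ} (hs : 0 < s) {g : Euc n → E} :
    Integrable g (sphereMeasure x₀ s) ↔
      Integrable (fun y : sphere (0 : Euc n) 1 => g (x₀ + s • (y : Euc n)))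
        (volume : Measure (Euc n)).toSphere := by
  unfold sphereMeasure
  rw [integrable_smul_measure (by simp; positivity) ENNReal.ofReal_ne_top,
    (measurableEmbedding_sphere x₀ hs).integrable_map_iff]
  rfl

theorem integral_sphereMeasure {E : Type*} [NormedAddCommGroup E] [NormedSpace ℝ E]
    (x₀ : Euc n) {s : ℝ} (hs : 0 < s) (g : Euc n → E) :
    ∫ x, g x ∂(sphereMeasure x₀ s) =
      s ^ (n - 1) • ∫ y : sphere (0 : Euc n) 1, g (x₀ + s • (y : Euc n))
        ∂(volume : Measure (Euc n)).toSphere := by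
  unfold sphereMeasure
  rw [integral_smul_measure, (measurableEmbedding_sphere x₀ hs).integral_map,
    ENNReal.toReal_ofReal (by positivity)]

theorem ae_sphereMeasure_iff (x₀ : Euc n) {s : ℝ} (hs : 0 < s) {P : Euc n → Prop} :
    (∀ᵐ x ∂(sphereMeasure x₀ s), P x) ↔
      ∀ᵐ y : sphere (0 : Euc n) 1 ∂(volume : Measure (Euc n)).toSphere,
        P (x₀ + s • (y : Euc n)) := by
  have h0 : ENNReal.ofReal (s ^ (n - 1)) ≠ 0 := by simp; positivity
  unfold sphereMeasure
  rw [← (measurableEmbedding_sphere x₀ hs).ae_map_iff, ae_iff, ae_iff, Measure.smul_apply,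
    smul_eq_mul, mul_eq_zero, or_iff_right h0]

theorem ae_norm_sub_eq (x₀ : Euc n) {s : ℝ} (hs : 0 < s) :
    ∀ᵐ x ∂(sphereMeasure x₀ s), ‖x - x₀‖ = s := by
  rw [ae_sphereMeasure_iff x₀ hs]
  refine Eventually.of_forall fun y => ?_
  simp [norm_smul, abs_of_pos hs]

/-- The density s^k is positive on (0,∞), so it does not change the null sets. -/
theorem ae_Ioi_iff_volumeIoiPow (k : ℕ) {P : ℝ → Prop} :
    (∀ᵐ s : Ioi (0 : ℝ) ∂(volumeIoiPow k), P s) ↔ ∀ᵐ s : ℝ, 0 < s → P s := by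
  unfold volumeIoiPow
  have h : ∀ P : ℝ → Prop, (∀ᵐ s : ℝ, 0 < s → P s) ↔
      ∀ᵐ s : Ioi (0 : ℝ) ∂(Measure.comap Subtype.val volume), P s := by
    intro P
    rw [← (MeasurableEmbedding.subtype_coe measurableSet_Ioi).ae_map_iff (p := P),
      map_comap_subtype_coe measurableSet_Ioi, ae_restrict_iff' measurableSet_Ioi]
    rfl
  rw [ae_withDensity_iff (by fun_prop), h P]
  refine eventually_congr (Eventually.of_forall fun s => ?_)
  have : ENNReal.ofReal (s.1 ^ k) ≠ 0 := by
    have := s.2.out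
    simp; positivity
  simp [this]

theorem integral_volumeIoiPow (k : ℕ) (f : ℝ → ℝ) :
    ∫ s : Ioi (0 : ℝ), f s ∂(volumeIoiPow k) = ∫ s in Ioi (0 : ℝ), s ^ k * f s := by
  simp only [volumeIoiPow, ENNReal.ofReal]
  rw [integral_withDensity_eq_integral_smul (by fun_prop),
    integral_subtype_comap measurableSet_Ioi fun a ↦ Real.toNNReal (a ^ k) • f a,
    setIntegral_congr_fun measurableSet_Ioi fun x hx ↦ ?_]
  rw [NNReal.smul_def, Real.coe_toNNReal _ (pow_nonneg hx.out.le _), smul_eq_mul]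

theorem integrable_volumeIoiPow_iff (k : ℕ) (f : ℝ → ℝ) :
    Integrable (fun s : Ioi (0 : ℝ) => f s) (volumeIoiPow k) ↔
      IntegrableOn (fun s => s ^ k * f s) (Ioi (0 : ℝ)) := by
  simp only [volumeIoiPow, ENNReal.ofReal]
  rw [integrable_withDensity_iff_integrable_smul (by fun_prop),
    integrableOn_iff_comap_subtypeVal measurableSet_Ioi]
  refine integrable_congr (Eventually.of_forall fun x => ?_)
  simp [NNReal.smul_def, Real.coe_toNNReal _ (pow_nonneg x.2.out.le _)]

theorem integrable_polar [NeZero n] (x₀ : Euc n) {g : Euc n → ℝ} (hg : Integrable g) :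
    (∀ᵐ s : ℝ, 0 < s → Integrable g (sphereMeasure x₀ s)) ∧
    IntegrableOn (fun s => ∫ x, g x ∂(sphereMeasure x₀ s)) (Ioi 0) ∧
    ∫ x, g x = ∫ s in Ioi (0 : ℝ), ∫ x, g x ∂(sphereMeasure x₀ s) := by
  have hP := measurePreserving_polarMap x₀
  have hi : Integrable (g ∘ polarMap x₀)
      ((volume : Measure (Euc n)).toSphere.prod (volumeIoiPow (n - 1))) :=
    (hP.integrable_comp_emb (measurableEmbedding_polarMap x₀)).2 hg
  have hcongr : ∀ s ∈ Ioi (0 : ℝ), s ^ (n - 1) * (∫ y : sphere (0 : Euc n) 1,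
      g (x₀ + s • (y : Euc n)) ∂(volume : Measure (Euc n)).toSphere) =
      ∫ x, g x ∂(sphereMeasure x₀ s) := fun s hs => by
    rw [integral_sphereMeasure x₀ hs, smul_eq_mul]
  refine ⟨?_, ?_, ?_⟩
  · have h := hi.prod_left_ae
    have h' := (ae_Ioi_iff_volumeIoiPow (n - 1) (P := fun s => Integrable (fun y :
      sphere (0 : Euc n) 1 => g (x₀ + s • (y : Euc n))) (volume : Measure (Euc n)).toSphere)).1 h
    filter_upwards [h'] with s h hs
    exact (integrable_sphereMeasure_iff x₀ hs).2 (h hs)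
  · have h := hi.integral_prod_right
    exact ((integrable_volumeIoiPow_iff (n - 1) fun s => ∫ y : sphere (0 : Euc n) 1,
      g (x₀ + s • (y : Euc n)) ∂(volume : Measure (Euc n)).toSphere).1 h).congr_fun hcongr
      measurableSet_Ioi
  · rw [← hP.integral_comp (measurableEmbedding_polarMap x₀)]
    have h := integral_prod_symm _ hi
    simp only [Function.comp] at h
    rw [h, ← setIntegral_congr_fun measurableSet_Ioi hcongr]
    exact integral_volumeIoiPow (n - 1) fun s => ∫ y : sphere (0 : Euc n) 1,
      g (x₀ + s • (y : Euc n)) ∂(volume : Measure (Euc n)).toSphere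

theorem ae_ae_sphereMeasure [NeZero n] (x₀ : Euc n) {P : Euc n → Prop} (hP : ∀ᵐ x, P x) :
    ∀ᵐ s : ℝ, 0 < s → ∀ᵐ x ∂(sphereMeasure x₀ s), P x := by
  have h1 := (measurePreserving_polarMap x₀).quasiMeasurePreserving.ae hP
  -- The factors are swapped so that the radius becomes the outer variable in Fubini's theorem.
  have h2 := Measure.ae_ae_of_ae_prod
    ((measurePreserving_swap (μ := volumeIoiPow (n - 1))
      (ν := (volume : Measure (Euc n)).toSphere)).quasiMeasurePreserving.ae h1)
  have h3 := (ae_Ioi_iff_volumeIoiPow (n - 1) (P := fun s => ∀ᵐ y : sphere (0 : Euc n) 1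
    ∂(volume : Measure (Euc n)).toSphere, P (x₀ + s • (y : Euc n)))).1 h2
  filter_upwards [h3] with s h hs
  exact (ae_sphereMeasure_iff x₀ hs).2 (h hs)

theorem ae_ae_sphereMeasure_of_ball [NeZero n] (x₀ : Euc n) (R : ℝ) {P : Euc n → Prop}
    (hP : ∀ᵐ x ∂(volume.restrict (ball x₀ R)), P x) :
    ∀ᵐ s : ℝ, s ∈ Ioo 0 R → ∀ᵐ x ∂(sphereMeasure x₀ s), P x := by
  filter_upwards [ae_ae_sphereMeasure x₀ ((ae_restrict_iff' measurableSet_ball).1 hP)] with s h hs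
  filter_upwards [h hs.1, ae_norm_sub_eq x₀ hs.1] with x hx hxs
  exact hx (by rw [mem_ball_iff_norm, hxs]; exact hs.2)

theorem integral_sphereMeasure_congr (x₀ : Euc n) {s : ℝ} (hs : 0 < s) {f g : Euc n → ℝ}
    (h : ∀ x, ‖x - x₀‖ = s → f x = g x) :
    ∫ x, f x ∂(sphereMeasure x₀ s) = ∫ x, g x ∂(sphereMeasure x₀ s) := by
  refine integral_congr_ae ?_
  filter_upwards [ae_norm_sub_eq x₀ hs] with x hx using h x hx

theorem integrable_polar_ball [NeZero n] (x₀ : Euc n) {R : ℝ} {g : Euc n → ℝ}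
    (hg : IntegrableOn g (ball x₀ R)) :
    (∀ᵐ s : ℝ, s ∈ Ioo 0 R → Integrable g (sphereMeasure x₀ s)) ∧
    IntegrableOn (fun s => ∫ x, g x ∂(sphereMeasure x₀ s)) (Ioo 0 R) ∧
    ∀ r ≤ R, ∫ x in ball x₀ r, g x = ∫ s in Ioo 0 r, ∫ x, g x ∂(sphereMeasure x₀ s) := by
  -- A sphere centred at x₀ lies entirely inside or entirely outside the ball, so the indicator
  -- depends on the radius alone.
  have key : ∀ r : ℝ, ∀ s ∈ Ioi (0 : ℝ), ∫ x, (ball x₀ r).indicator g x ∂(sphereMeasure x₀ s) =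
      (Iio r).indicator (fun s => ∫ x, g x ∂(sphereMeasure x₀ s)) s := by
    intro r s hs
    by_cases h : s < r
    · rw [indicator_of_mem (mem_Iio.2 h)]
      refine integral_sphereMeasure_congr x₀ hs fun x hx => indicator_of_mem ?_ _
      rwa [mem_ball_iff_norm, hx]
    · rw [indicator_of_notMem (mt mem_Iio.1 h),
        integral_sphereMeasure_congr x₀ hs (g := fun _ => 0) fun x hx => indicator_of_notMem ?_ _,
        integral_zero]
      rwa [mem_ball_iff_norm, hx]
  have hset : ∀ r : ℝ, Ioi (0 : ℝ) ∩ Iio r = Ioo 0 r := fun r => rfl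
  refine ⟨?_, ?_, fun r hr => ?_⟩
  · filter_upwards [(integrable_polar x₀ (hg.integrable_indicator measurableSet_ball)).1]
      with s hs h
    refine (hs h.1).congr ?_
    filter_upwards [ae_norm_sub_eq x₀ h.1] with x hx
    refine indicator_of_mem ?_ _
    rw [mem_ball_iff_norm, hx]
    exact h.2
  · have h := (integrable_polar x₀ (hg.integrable_indicator measurableSet_ball)).2.1
    have h := h.congr_fun (key R) measurableSet_Ioi
    rwa [integrableOn_indicator_iff measurableSet_Iio, inter_comm, hset] at h
  · have h := (integrable_polar x₀
      ((hg.mono_set (ball_subset_ball hr)).integrable_indicator measurableSet_ball)).2.2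
    rwa [integral_indicator measurableSet_ball, setIntegral_congr_fun measurableSet_Ioi (key r),
      setIntegral_indicator measurableSet_Iio, hset] at h

/-! ### Radial test functions -/

/-- Integration by parts for a smooth function against a primitive of an integrable function. -/
theorem integral_deriv_mul_add_mul_eq_sub {a α η η' : ℝ → ℝ} {ρ σ : ℝ} (hρσ : ρ ≤ σ)
    (ha : IntervalIntegrable a volume ρ σ) (hα : ∀ t ∈ Icc ρ σ, α t - α ρ = ∫ s in ρ..t, a s)
    (hη : ContDiffOn ℝ 1 η (Icc ρ σ)) (hη' : ∀ t ∈ Icc ρ σ, HasDerivAt η (η' t) t) :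
    ∫ t in ρ..σ, (η' t * α t + η t * a t) = η σ * α σ - η ρ * α ρ := by
  -- `α` is controlled only on [ρ,σ]; this primitive agrees with it there and has derivative `a`
  -- almost everywhere on the interval, endpoints causing no trouble.
  set α' : ℝ → ℝ := fun t => (∫ s in ρ..t, a s) + α ρ
  have hα' : ∀ t ∈ Icc ρ σ, α t = α' t := fun t ht => by
    have := hα t ht
    simp only [α']; linarith
  have hac : AbsolutelyContinuousOnInterval α' ρ σ :=
    (ha.absolutelyContinuousOnInterval_intervalIntegral (c := ρ) (by simp)).add
      ((contDiff_const (c := α ρ)).contDiffOn.absolutelyContinuousOnInterval)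
  have hη0 : AbsolutelyContinuousOnInterval η ρ σ := by
    refine ContDiffOn.absolutelyContinuousOnInterval ?_
    rwa [uIcc_of_le hρσ]
  have h := hη0.integral_deriv_mul_eq_sub hac
  rw [hα' σ (right_mem_Icc.2 hρσ), hα' ρ (left_mem_Icc.2 hρσ), ← h]
  refine intervalIntegral.integral_congr_ae ?_
  filter_upwards [ha.ae_hasDerivAt_integral] with t h1 h2
  have ht : t ∈ uIcc ρ σ := uIoc_subset_uIcc h2
  have ht' : t ∈ Icc ρ σ := by rwa [uIcc_of_le hρσ] at ht
  rw [(hη' t ht').deriv, ((h1 ht ρ (by simp)).add_const (α ρ)).deriv, hα' t ht']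

/-- Smooth profiles that are constant near `0` and vanish near and beyond `δ`. -/
structure IsRadialTest (δ : ℝ) (η : ℝ → ℝ) : Prop where
  contDiff : ContDiff ℝ ∞ η
  const_near_zero : ∃ ε > 0, ∀ s ≤ ε, η s = η 0
  zero_near : ∃ r, 0 < r ∧ r < δ ∧ ∀ s, r ≤ s → η s = 0

/-- The unit radial direction at `x`, seen from `x₀`. -/
noncomputable def radialDir (x₀ x : Euc n) : Euc n := sphereNormal x₀ ‖x - x₀‖ x

theorem IsRadialTest.deriv_zero {δ : ℝ} {η : ℝ → ℝ} (hη : IsRadialTest δ η) : deriv η 0 = 0 := by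
  obtain ⟨ε, hε, h⟩ := hη.const_near_zero
  have : η =ᶠ[𝓝 0] fun _ => η 0 := by
    filter_upwards [Iio_mem_nhds hε] with s hs using h s (le_of_lt hs)
  rw [this.deriv_eq, deriv_const]

theorem IsRadialTest.deriv_eq_zero {δ : ℝ} {η : ℝ → ℝ} (hη : IsRadialTest δ η) :
    ∃ r, 0 < r ∧ r < δ ∧ ∀ s, r ≤ s → η s = 0 ∧ deriv η s = 0 := by
  obtain ⟨r, h0, hr, h⟩ := hη.zero_near
  refine ⟨(r + δ) / 2, by linarith, by linarith, fun s hs => ⟨h s (by linarith), ?_⟩⟩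
  have : η =ᶠ[𝓝 s] fun _ => 0 := by
    filter_upwards [Ioi_mem_nhds (show r < s by linarith)] with t ht using h t (le_of_lt ht)
  rw [this.deriv_eq, deriv_const]

theorem IsRadialTest.eventually_const {δ : ℝ} {η : ℝ → ℝ} (hη : IsRadialTest δ η) (x₀ : Euc n) :
    (fun x => η ‖x - x₀‖) =ᶠ[𝓝 x₀] fun _ => η 0 := by
  obtain ⟨ε, hε, h⟩ := hη.const_near_zero
  filter_upwards [ball_mem_nhds x₀ hε] with x hx
  exact h _ (le_of_lt (mem_ball_iff_norm.1 hx))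

/-- The norm is singular only at the centre, where the profile is constant. -/
theorem IsRadialTest.contDiff_radial {δ : ℝ} {η : ℝ → ℝ} (hη : IsRadialTest δ η) (x₀ : Euc n) :
    ContDiff ℝ ∞ (fun x => η ‖x - x₀‖) := by
  rw [contDiff_iff_contDiffAt]
  intro x
  by_cases hx : x = x₀
  · subst hx
    exact contDiffAt_const.congr_of_eventuallyEq (hη.eventually_const x)
  · exact hη.contDiff.contDiffAt.comp x
      ((contDiffAt_id.sub contDiffAt_const).norm ℝ (sub_ne_zero.2 hx))

theorem IsRadialTest.hasFDerivAt_radial {δ : ℝ} {η : ℝ → ℝ} (hη : IsRadialTest δ η)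
    (x₀ x : Euc n) :
    HasFDerivAt (fun x => η ‖x - x₀‖) (deriv η ‖x - x₀‖ • innerSL ℝ (radialDir x₀ x)) x := by
  by_cases hx : x = x₀
  · subst hx
    simp only [sub_self, norm_zero, hη.deriv_zero, zero_smul]
    exact (hasFDerivAt_const (η 0) x).congr_of_eventuallyEq (hη.eventually_const x)
  · have h1 : HasFDerivAt (fun y : Euc n => ‖y - x₀‖) (innerSL ℝ (radialDir x₀ x)) x := by
      have h0 : x - x₀ ≠ 0 := sub_ne_zero.2 hx
      have h2 : HasFDerivAt (fun y : Euc n => y - x₀) (ContinuousLinearMap.id ℝ (Euc n)) x :=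
        (hasFDerivAt_id x).sub_const x₀
      have h3 := (h2.norm_sq).sqrt (by positivity)
      simp only [Real.sqrt_sq (norm_nonneg _)] at h3
      convert! h3 using 1
      ext e
      simp [radialDir, sphereNormal]
      field_simp
    have h2 : HasDerivAt η (deriv η ‖x - x₀‖) ‖x - x₀‖ :=
      (hη.contDiff.differentiable (by simp)).differentiableAt.hasDerivAt
    exact h2.comp_hasFDerivAt x h1

theorem IsRadialTest.tsupport_subset {δ : ℝ} {η : ℝ → ℝ} (hη : IsRadialTest δ η) (x₀ : Euc n) :
    ∃ r, 0 < r ∧ r < δ ∧ tsupport (fun x => η ‖x - x₀‖) ⊆ closedBall x₀ r := by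
  obtain ⟨r, h0, hr, h⟩ := hη.zero_near
  refine ⟨r, h0, hr, closure_minimal (fun x hx => ?_) isClosed_closedBall⟩
  rw [mem_closedBall_iff_norm]
  by_contra hlt
  exact hx (h _ (le_of_lt (not_le.1 hlt)))

theorem exists_subset_Ioo_of_isCompact {δ : ℝ} {K : Set ℝ} (hδ : 0 < δ) (hK : IsCompact K)
    (hKδ : K ⊆ Ioo 0 δ) : ∃ ε r, 0 < ε ∧ ε < r ∧ r < δ ∧ K ⊆ Ioo ε r := by
  -- Adding the midpoint covers the case of empty `K`: least and greatest elements then exist.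
  have hK' : IsCompact (insert (δ / 2) K) := hK.insert _
  have hsub : insert (δ / 2) K ⊆ Ioo 0 δ :=
    insert_subset ⟨by linarith, by linarith⟩ hKδ
  obtain ⟨p, hp, hpmin⟩ := hK'.exists_isLeast (insert_nonempty _ _)
  obtain ⟨q, hq, hqmax⟩ := hK'.exists_isGreatest (insert_nonempty _ _)
  have h1 := hsub hp
  have h2 := hsub hq
  have h3 := hpmin hq
  simp only [mem_Ioo] at h1 h2
  refine ⟨p / 2, (q + δ) / 2, by linarith, by linarith, by linarith, fun x hx => ?_⟩
  have h4 := hpmin (mem_insert_of_mem _ hx)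
  have h5 := hqmax (mem_insert_of_mem _ hx)
  exact ⟨by linarith, by linarith⟩

/-- The primitive is taken from δ, so it vanishes near δ and is constant near 0. As its value at 0
is free, no mean-zero condition on `χ` is needed: derivatives of radial profiles exhaust the test
functions on (0,δ). -/
theorem exists_isRadialTest {δ : ℝ} (hδ : 0 < δ) {χ : ℝ → ℝ} (hχ : ContDiff ℝ ∞ χ)
    (hχc : HasCompactSupport χ) (hχs : tsupport χ ⊆ Ioo 0 δ) :
    ∃ η, IsRadialTest δ η ∧ deriv η = χ := by
  obtain ⟨ε, r, hε, hεr, hr, hsub⟩ := exists_subset_Ioo_of_isCompact hδ hχc hχs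
  have hz : ∀ t, t ≤ ε ∨ r ≤ t → χ t = 0 := fun t ht => by
    refine image_eq_zero_of_notMem_tsupport fun h => ?_
    have := hsub h
    rcases ht with ht | ht
    · exact absurd this.1 (not_lt.2 ht)
    · exact absurd this.2 (not_lt.2 ht)
  have hd : ∀ s, HasDerivAt (fun s => ∫ t in δ..s, χ t) (χ s) s := fun s =>
    intervalIntegral.integral_hasDerivAt_right (hχ.continuous.intervalIntegrable _ _)
      (hχ.continuous.stronglyMeasurableAtFilter _ _) hχ.continuous.continuousAt
  have hderiv : deriv (fun s => ∫ t in δ..s, χ t) = χ := funext fun s => (hd s).deriv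
  refine ⟨fun s => ∫ t in δ..s, χ t, ⟨?_, ⟨ε, hε, fun s hs => ?_⟩, ⟨r, by linarith, hr,
    fun s hs => ?_⟩⟩, hderiv⟩
  · rw [contDiff_infty_iff_deriv, hderiv]
    exact ⟨fun s => (hd s).differentiableAt, hχ⟩
  · have : ∫ t in (0 : ℝ)..s, χ t = 0 := by
      rw [intervalIntegral.integral_congr (g := fun _ => 0) fun t ht => hz t (Or.inl ?_)]
      · simp
      · have := ht.2
        exact this.trans (max_le hε.le hs)
    have h2 := intervalIntegral.integral_add_adjacent_intervals
      (hχ.continuous.intervalIntegrable (μ := volume) δ 0)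
      (hχ.continuous.intervalIntegrable (μ := volume) 0 s)
    linarith
  · rw [intervalIntegral.integral_congr (g := fun _ => 0) fun t ht => hz t (Or.inr ?_)]
    · simp
    · exact (le_min hr.le hs).trans ht.1

/-! ### Integrals over balls as functions of the radius -/

theorem integral_ball_eq_intervalIntegral [NeZero n] (x₀ : Euc n) {R r : ℝ} {g : Euc n → ℝ}
    (hg : IntegrableOn g (ball x₀ R)) (h0 : 0 ≤ r) (hr : r ≤ R) :
    ∫ x in ball x₀ r, g x = ∫ s in (0 : ℝ)..r, ∫ x, g x ∂(sphereMeasure x₀ s) := by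
  rw [(integrable_polar_ball x₀ hg).2.2 r hr, intervalIntegral.integral_of_le h0,
    integral_Ioc_eq_integral_Ioo]

theorem intervalIntegrable_sphere [NeZero n] (x₀ : Euc n) {R : ℝ} {g : Euc n → ℝ}
    (hg : IntegrableOn g (ball x₀ R)) {ρ σ : ℝ} (hρ : 0 ≤ ρ) (hρσ : ρ ≤ σ) (hσ : σ ≤ R) :
    IntervalIntegrable (fun s => ∫ x, g x ∂(sphereMeasure x₀ s)) volume ρ σ := by
  rw [intervalIntegrable_iff_integrableOn_Ioo_of_le hρσ]
  exact (integrable_polar_ball x₀ hg).2.1.mono_set (Ioo_subset_Ioo hρ hσ)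

theorem continuousOn_integral_ball [NeZero n] (x₀ : Euc n) {R : ℝ} (hR : 0 ≤ R) {g : Euc n → ℝ}
    (hg : IntegrableOn g (ball x₀ R)) :
    ContinuousOn (fun s => ∫ x in ball x₀ s, g x) (Icc 0 R) := by
  have h0 := intervalIntegrable_sphere x₀ hg le_rfl hR le_rfl
  have h := intervalIntegral.continuousOn_primitive_interval (μ := volume)
    ((intervalIntegrable_iff' (by simp)).1 h0)
  rw [uIcc_of_le hR] at h
  exact h.congr fun s hs => integral_ball_eq_intervalIntegral x₀ hg hs.1 hs.2

/-- A divergence identity tested with all radial profiles gives the Gauss--Green identity on almost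
every ball. -/
theorem ae_integral_sphere_eq_integral_ball [NeZero n] (x₀ : Euc n) {δ : ℝ} (hδ : 0 < δ)
    {A B : Euc n → ℝ} (hA : ∀ r < δ, IntegrableOn A (ball x₀ r))
    (hB : ∀ r < δ, IntegrableOn B (ball x₀ r))
    (h : ∀ η, IsRadialTest δ η →
      ∫ x in ball x₀ δ, (η ‖x - x₀‖ * A x + deriv η ‖x - x₀‖ * B x) = 0) :
    ∀ᵐ s : ℝ, s ∈ Ioo 0 δ → ∫ x, B x ∂(sphereMeasure x₀ s) = ∫ x in ball x₀ s, A x := by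
  set a : ℝ → ℝ := fun s => ∫ x, A x ∂(sphereMeasure x₀ s)
  set b : ℝ → ℝ := fun s => ∫ x, B x ∂(sphereMeasure x₀ s)
  set α : ℝ → ℝ := fun s => ∫ x in ball x₀ s, A x
  have hα : ∀ r < δ, ∀ t ∈ Icc 0 r, α t - α 0 = ∫ s in (0 : ℝ)..t, a s := by
    intro r hr t ht
    simp only [α, a]
    rw [integral_ball_eq_intervalIntegral x₀ (hA r hr) ht.1 ht.2, ball_zero]
    simp
  have hai : ∀ r, 0 ≤ r → r < δ → IntervalIntegrable a volume 0 r := fun r h0 hr =>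
    intervalIntegrable_sphere x₀ (hA r hr) le_rfl h0 le_rfl
  have hbi : ∀ r, 0 ≤ r → r < δ → IntervalIntegrable b volume 0 r := fun r h0 hr =>
    intervalIntegrable_sphere x₀ (hB r hr) le_rfl h0 le_rfl
  have hαi : ∀ r, 0 ≤ r → r < δ → IntervalIntegrable α volume 0 r := fun r h0 hr => by
    refine ContinuousOn.intervalIntegrable ?_
    rw [uIcc_of_le h0]
    exact continuousOn_integral_ball x₀ h0 (hA r hr)
  -- In polar coordinates the hypothesis reads ∫ (η a + η' b) = 0. Since α' = a, integration by
  -- parts turns it into ∫ η' (b - α) = 0, where η' is an arbitrary test function.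
  have key : ∀ᵐ s : ℝ, s ∈ Ioo 0 δ → b s - α s = 0 := by
    refine isOpen_Ioo.ae_eq_zero_of_integral_contDiff_smul_eq_zero ?_ ?_
    · rw [locallyIntegrableOn_iff isOpen_Ioo.isLocallyClosed]
      intro K hK hKc
      obtain ⟨ε, r, hε, hεr, hr, hsub⟩ := exists_subset_Ioo_of_isCompact hδ hKc hK
      have h0 : 0 ≤ r := by linarith
      have := (hbi r h0 hr).sub (hαi r h0 hr)
      rw [intervalIntegrable_iff_integrableOn_Ioo_of_le h0] at this
      exact this.mono_set (hsub.trans (Ioo_subset_Ioo_left hε.le))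
    · intro χ hχ hχc hχs
      obtain ⟨η, hη, rfl⟩ := exists_isRadialTest hδ hχ hχc hχs
      obtain ⟨r, h0, hr, hz⟩ := hη.deriv_eq_zero
      have hcont : Continuous fun x : Euc n => ‖x - x₀‖ := by fun_prop
      have hcη : Continuous fun x : Euc n => η ‖x - x₀‖ := hη.contDiff.continuous.comp hcont
      have hcη' : Continuous fun x : Euc n => deriv η ‖x - x₀‖ := hχ.continuous.comp hcont
      have hsub : closedBall x₀ r ⊆ ball x₀ ((r + δ) / 2) :=
        closedBall_subset_ball (by linarith)
      have hi1 : IntegrableOn (fun x => η ‖x - x₀‖ * A x) (ball x₀ r) :=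
        (((hA _ (by linarith)).mono_set hsub).continuousOn_mul hcη.continuousOn
          (isCompact_closedBall x₀ r)).mono_set ball_subset_closedBall
      have hi2 : IntegrableOn (fun x => deriv η ‖x - x₀‖ * B x) (ball x₀ r) :=
        (((hB _ (by linarith)).mono_set hsub).continuousOn_mul hcη'.continuousOn
          (isCompact_closedBall x₀ r)).mono_set ball_subset_closedBall
      have h1 := h η hη
      rw [setIntegral_eq_of_subset_of_forall_sdiff_eq_zero measurableSet_ball
        (ball_subset_ball hr.le) (fun x hx => by
          have := hz ‖x - x₀‖ (not_lt.1 (mt mem_ball_iff_norm.2 hx.2))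
          simp [this.1, this.2]), integral_add hi1 hi2,
        integral_ball_eq_intervalIntegral x₀ hi1 h0.le le_rfl,
        integral_ball_eq_intervalIntegral x₀ hi2 h0.le le_rfl] at h1
      have e : ∀ (f : ℝ → ℝ) (g : Euc n → ℝ), ∫ s in (0 : ℝ)..r,
          ∫ x, f ‖x - x₀‖ * g x ∂(sphereMeasure x₀ s) =
          ∫ s in (0 : ℝ)..r, f s * ∫ x, g x ∂(sphereMeasure x₀ s) := by
        intro f g
        refine intervalIntegral.integral_congr_ae (Eventually.of_forall fun s hs => ?_)
        rw [uIoc_of_le h0.le] at hs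
        rw [← integral_const_mul]
        exact integral_sphereMeasure_congr x₀ hs.1 fun x hx => by rw [hx]
      rw [e, e] at h1
      have h2 := integral_deriv_mul_add_mul_eq_sub h0.le (hai r h0.le hr) (hα r hr)
        (hη.contDiff.of_le (by simp)).contDiffOn
        (fun t _ => (hη.contDiff.differentiable (by simp)).differentiableAt.hasDerivAt)
      -- Both boundary terms vanish: α at 0, and η at r.
      have hα0 : α 0 = 0 := by simp [α]
      rw [(hz r le_rfl).1, hα0, mul_zero, zero_mul, sub_zero, intervalIntegral.integral_add
        ((hαi r h0.le hr).continuousOn_mul hχ.continuous.continuousOn)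
        ((hai r h0.le hr).continuousOn_mul hη.contDiff.continuous.continuousOn)] at h2
      have h3 : ∫ s, deriv η s • (b s - α s) = ∫ s in (0 : ℝ)..r, deriv η s * (b s - α s) := by
        rw [intervalIntegral.integral_of_le h0.le]
        refine (setIntegral_eq_integral_of_forall_compl_eq_zero fun s hs => ?_).symm
        by_cases hs0 : 0 < s
        · have : r < s := by
            by_contra hcon
            exact hs ⟨hs0, not_lt.1 hcon⟩
          simp [(hz s this.le).2]
        · have : deriv η s = 0 := image_eq_zero_of_notMem_tsupport fun hmem => hs0 (hχs hmem).1
          simp [this]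
      rw [h3]
      simp only [mul_sub]
      rw [intervalIntegral.integral_sub
        ((hbi r h0.le hr).continuousOn_mul hχ.continuous.continuousOn)
        ((hαi r h0.le hr).continuousOn_mul hχ.continuous.continuousOn)]
      simp only [a, b] at h1 h2 ⊢
      linarith
  filter_upwards [key] with s hs hsδ using sub_eq_zero.1 (hs hsδ)

/-! ### The divergence theorem on balls -/

theorem measurable_radialDir (x₀ : Euc n) : Measurable (radialDir x₀) := by
  unfold radialDir sphereNormal
  fun_prop

theorem norm_radialDir_le (x₀ x : Euc n) : ‖radialDir x₀ x‖ ≤ 1 := by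
  unfold radialDir sphereNormal
  rw [norm_smul, norm_inv, norm_norm]
  exact inv_mul_le_one

theorem radialDir_eq (x₀ : Euc n) {x : Euc n} {s : ℝ} (h : ‖x - x₀‖ = s) :
    radialDir x₀ x = sphereNormal x₀ s x := by
  unfold radialDir
  rw [h]

theorem norm_sphereNormal (x₀ : Euc n) {x : Euc n} {s : ℝ} (hs : 0 < s) (h : ‖x - x₀‖ = s) :
    ‖sphereNormal x₀ s x‖ = 1 := by
  unfold sphereNormal
  rw [norm_smul, h, norm_inv, Real.norm_of_nonneg hs.le, inv_mul_cancel₀ hs.ne']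

theorem inner_sub_eq_norm_mul_inner_radialDir (x₀ x g : Euc n) :
    inner ℝ g (x - x₀) = ‖x - x₀‖ * inner ℝ g (radialDir x₀ x) := by
  unfold radialDir sphereNormal
  rw [inner_smul_right]
  by_cases h : x = x₀
  · simp [h]
  · have : ‖x - x₀‖ ≠ 0 := by simpa [sub_eq_zero] using h
    field_simp

theorem continuous_divergence {φ : Euc n → Euc n} (hφ : ContDiff ℝ 1 φ) :
    Continuous (divergence φ) := by
  unfold divergence
  have := hφ.continuous_fderiv (by simp)
  fun_prop

theorem divergence_eq_sum_fderiv_coord {φ : Euc n → Euc n} (hφ : Differentiable ℝ φ) (x : Euc n) :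
    divergence φ x =
      ∑ j, fderiv ℝ (fun y => φ y j) x (EuclideanSpace.single j 1) := by
  unfold divergence
  refine Finset.sum_congr rfl fun j _ => ?_
  have h := ((EuclideanSpace.proj (𝕜 := ℝ) j : Euc n →L[ℝ] ℝ).hasFDerivAt.comp x
    (hφ x).hasFDerivAt).fderiv
  have h' : fderiv ℝ (fun y => φ y j) x =
    (EuclideanSpace.proj (𝕜 := ℝ) j : Euc n →L[ℝ] ℝ).comp (fderiv ℝ φ x) := h
  rw [h']
  rfl

theorem sum_mul_inner_single (v w : Euc n) :
    ∑ j, inner ℝ v (EuclideanSpace.single j 1) * w j = inner ℝ v w := by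
  simp [PiLp.inner_apply, mul_comm]

theorem divergence_smul {ζ : Euc n → ℝ} {φ : Euc n → Euc n} {x : Euc n}
    (hζ : DifferentiableAt ℝ ζ x) (hφ : DifferentiableAt ℝ φ x) :
    divergence (fun y => ζ y • φ y) x = ζ x * divergence φ x + fderiv ℝ ζ x (φ x) := by
  unfold divergence
  have h : fderiv ℝ (fun y => ζ y • φ y) x = _ := fderiv_fun_smul hζ hφ
  rw [h]
  have h2 : fderiv ℝ ζ x (φ x) = ∑ j, fderiv ℝ ζ x (EuclideanSpace.single j 1) * φ x j := by
    have : φ x = ∑ j, (φ x j) • EuclideanSpace.single j (1 : ℝ) := by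
      ext i
      simp [Finset.sum_apply, Pi.single_apply]
    conv_lhs => rw [this]
    simp [mul_comm]
  rw [h2, Finset.mul_sum, ← Finset.sum_add_distrib]
  refine Finset.sum_congr rfl fun j _ => ?_
  simp

theorem divergence_sub_const (x₀ x : Euc n) : divergence (fun y => y - x₀) x = n := by
  unfold divergence
  simp [fderiv_sub_const]

/-- The integrand is the divergence of the compactly supported field ζψ; each partial derivative
integrates to zero, by parts against the constant 1. -/
theorem integral_mul_divergence_eq_neg {ζ : Euc n → ℝ} {ψ : Euc n → Euc n}
    (hζ : ContDiff ℝ 1 ζ) (hζc : HasCompactSupport ζ) (hψ : ContDiff ℝ 1 ψ) :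
    ∫ x, (ζ x * divergence ψ x + fderiv ℝ ζ x (ψ x)) = 0 := by
  have h1 : ∀ x, ζ x * divergence ψ x + fderiv ℝ ζ x (ψ x) =
      ∑ j, fderiv ℝ (fun y => ζ y * ψ y j) x (EuclideanSpace.single j 1) := fun x => by
    rw [← divergence_smul (hζ.differentiable (by simp) x) (hψ.differentiable (by simp) x),
      divergence_eq_sum_fderiv_coord]
    · rfl
    · exact (hζ.smul hψ).differentiable (by simp)
  have hj : ∀ j, ContDiff ℝ 1 (fun y => ψ y j) := fun j => by fun_prop
  have hc : ∀ j, HasCompactSupport (fun y => ζ y * ψ y j) := fun j => hζc.mul_right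
  have hd : ∀ j, ContDiff ℝ 1 (fun y => ζ y * ψ y j) := fun j => hζ.mul (hj j)
  have hint : ∀ j, Integrable
      fun x => fderiv ℝ (fun y => ζ y * ψ y j) x (EuclideanSpace.single j 1) := fun j => by
    refine Continuous.integrable_of_hasCompactSupport ?_ ?_
    · have := (hd j).continuous_fderiv (by simp)
      fun_prop
    · exact ((hc j).fderiv (𝕜 := ℝ)).comp_left (g := fun L : Euc n →L[ℝ] ℝ =>
        L (EuclideanSpace.single j 1)) rfl
  simp only [h1]
  rw [integral_finsetSum _ fun j _ => hint j]
  refine Finset.sum_eq_zero fun j _ => ?_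
  have := integral_mul_fderiv_eq_neg_fderiv_mul_of_integrable (μ := (volume : Measure (Euc n)))
    (f := fun _ : Euc n => (1 : ℝ)) (g := fun y => ζ y * ψ y j)
    (v := EuclideanSpace.single j 1) (by simp)
    (by simpa using hint j)
    (by simpa using (hd j).continuous.integrable_of_hasCompactSupport (hc j))
    (fun _ _ => differentiableAt_const _)
    (fun x _ => (hd j).differentiable (by simp) x)
  simpa using this

theorem IsRadialTest.hasCompactSupport {δ : ℝ} {η : ℝ → ℝ} (hη : IsRadialTest δ η) (x₀ : Euc n) :
    HasCompactSupport (fun x => η ‖x - x₀‖) := by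
  obtain ⟨r, -, -, h⟩ := hη.tsupport_subset x₀
  exact (isCompact_closedBall x₀ r).of_isClosed_subset (isClosed_tsupport _) h

/-- Rescaling to the unit sphere puts the radius into the integrand. The continuity serves to pass
from almost every radius to every radius. -/
theorem continuousOn_integral_sphere_inner (x₀ : Euc n) {ψ : Euc n → Euc n} (hψ : Continuous ψ) :
    ContinuousOn (fun s => ∫ x, inner ℝ (ψ x) (sphereNormal x₀ s x) ∂(sphereMeasure x₀ s))
      (Ioi 0) := by
  have h : Continuous fun s : ℝ => s ^ (n - 1) * ∫ y : sphere (0 : Euc n) 1 in univ,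
      inner ℝ (ψ (x₀ + s • (y : Euc n))) (y : Euc n) ∂(volume : Measure (Euc n)).toSphere :=
    (continuous_pow _).mul (continuous_parametric_integral_of_continuous
      (by simp only [Function.uncurry_def]; fun_prop) isCompact_univ)
  refine h.continuousOn.congr fun s hs => ?_
  have hs : 0 < s := hs
  rw [integral_sphereMeasure x₀ hs, smul_eq_mul, Measure.restrict_univ]
  simp [sphereNormal, smul_smul, inv_mul_cancel₀ hs.ne']

/-- The divergence theorem on a ball. -/
theorem integral_ball_divergence [NeZero n] (x₀ : Euc n) {ψ : Euc n → Euc n}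
    (hψ : ContDiff ℝ 1 ψ) {s : ℝ} (hs : 0 < s) :
    ∫ x in ball x₀ s, divergence ψ x
      = ∫ x, inner ℝ (ψ x) (sphereNormal x₀ s x) ∂(sphereMeasure x₀ s) := by
  have hA : ∀ r, IntegrableOn (divergence ψ) (ball x₀ r) := fun r =>
    ((continuous_divergence hψ).continuousOn.integrableOn_compact
      (isCompact_closedBall x₀ r)).mono_set ball_subset_closedBall
  have hB : ∀ r, IntegrableOn (fun x => inner ℝ (ψ x) (radialDir x₀ x)) (ball x₀ r) := fun r => by
    refine Integrable.mono' (g := fun x => ‖ψ x‖)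
      ((hψ.continuous.norm.continuousOn.integrableOn_compact
        (isCompact_closedBall x₀ r)).mono_set ball_subset_closedBall) ?_ ?_
    · exact (hψ.continuous.aestronglyMeasurable).inner
        (measurable_radialDir x₀).aestronglyMeasurable
    · refine Eventually.of_forall fun x => (norm_inner_le_norm _ _).trans ?_
      exact mul_le_of_le_one_right (norm_nonneg _) (norm_radialDir_le x₀ x)
  -- The radius s + 1 leaves s in the interior of the interval of radii.
  have hae := ae_integral_sphere_eq_integral_ball x₀ (show 0 < s + 1 by linarith)
    (fun r _ => hA r) (fun r _ => hB r) (fun η hη => by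
      obtain ⟨r, h0, hr, hz⟩ := hη.deriv_eq_zero
      rw [setIntegral_eq_integral_of_forall_compl_eq_zero fun x hx => by
        have := hz ‖x - x₀‖ (hr.le.trans (not_lt.1 (mt mem_ball_iff_norm.2 hx)))
        simp [this.1, this.2]]
      rw [← integral_mul_divergence_eq_neg ((hη.contDiff_radial x₀).of_le (by simp))
        (hη.hasCompactSupport x₀) hψ]
      refine integral_congr_ae (Eventually.of_forall fun x => ?_)
      simp only
      rw [(hη.hasFDerivAt_radial x₀ x).fderiv]
      simp [real_inner_comm])
  -- Both sides are continuous in the radius, so equality almost everywhere is equality everywhere.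
  have heq := eqOn_open_of_ae_eq (μ := (volume : Measure ℝ)) (U := Ioo 0 (s + 1))
    (f := fun t => ∫ x in ball x₀ t, divergence ψ x)
    (g := fun t => ∫ x, inner ℝ (ψ x) (sphereNormal x₀ t x) ∂(sphereMeasure x₀ t))
    (by
      rw [EventuallyEq, ae_restrict_iff' measurableSet_Ioo]
      filter_upwards [hae] with t ht htm
      rw [← ht htm]
      exact integral_sphereMeasure_congr x₀ htm.1 fun x hx => by rw [radialDir_eq x₀ hx])
    isOpen_Ioo
    ((continuousOn_integral_ball x₀ (by linarith) (hA (s + 1))).mono Ioo_subset_Icc_self)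
    ((continuousOn_integral_sphere_inner x₀ hψ.continuous).mono fun t ht => ht.1)
  exact heq ⟨hs, by linarith⟩

/-! ### Convergence in `L²` -/

theorem tendsto_integral_inner {α H : Type*} [MeasurableSpace α] {μ : Measure α}
    [NormedAddCommGroup H] [InnerProductSpace ℝ H] {p q : ℕ → α → H} {p₀ q₀ : α → H}
    (hp : ∀ k, MemLp (p k) 2 μ) (hq : ∀ k, MemLp (q k) 2 μ) (hp₀ : MemLp p₀ 2 μ)
    (hq₀ : MemLp q₀ 2 μ) (hpt : Tendsto (fun k => eLpNorm (p k - p₀) 2 μ) atTop (𝓝 0))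
    (hqt : Tendsto (fun k => eLpNorm (q k - q₀) 2 μ) atTop (𝓝 0)) :
    Tendsto (fun k => ∫ x, inner ℝ (p k x) (q k x) ∂μ) atTop
      (𝓝 (∫ x, inner ℝ (p₀ x) (q₀ x) ∂μ)) := by
  have h1 := (Lp.tendsto_Lp_iff_tendsto_eLpNorm'' p hp p₀ hp₀).2 hpt
  have h2 := (Lp.tendsto_Lp_iff_tendsto_eLpNorm'' q hq q₀ hq₀).2 hqt
  have e : ∀ {a b : α → H} (ha : MemLp a 2 μ) (hb : MemLp b 2 μ),
      inner ℝ (ha.toLp a) (hb.toLp b) = ∫ x, inner ℝ (a x) (b x) ∂μ := by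
    intro a b ha hb
    rw [L2.inner_def]
    refine integral_congr_ae ?_
    filter_upwards [ha.coeFn_toLp, hb.coeFn_toLp] with x h1 h2
    rw [h1, h2]
  have h3 := h1.inner (𝕜 := ℝ) h2
  simpa only [e] using h3

theorem tendsto_integral_mul {α : Type*} [MeasurableSpace α] {μ : Measure α}
    {p q : ℕ → α → ℝ} {p₀ q₀ : α → ℝ}
    (hp : ∀ k, MemLp (p k) 2 μ) (hq : ∀ k, MemLp (q k) 2 μ) (hp₀ : MemLp p₀ 2 μ)
    (hq₀ : MemLp q₀ 2 μ) (hpt : Tendsto (fun k => eLpNorm (p k - p₀) 2 μ) atTop (𝓝 0))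
    (hqt : Tendsto (fun k => eLpNorm (q k - q₀) 2 μ) atTop (𝓝 0)) :
    Tendsto (fun k => ∫ x, p k x * q k x ∂μ) atTop (𝓝 (∫ x, p₀ x * q₀ x ∂μ)) := by
  have h := tendsto_integral_inner hp hq hp₀ hq₀ hpt hqt
  simpa [mul_comm] using h

theorem eLpNorm_two_eq {α H : Type*} [MeasurableSpace α] {μ : Measure α}
    [NormedAddCommGroup H] {f : α → H} (hf : MemLp f 2 μ) :
    eLpNorm f 2 μ = ENNReal.ofReal (√(∫ x, ‖f x‖ ^ 2 ∂μ)) := by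
  rw [hf.eLpNorm_eq_integral_rpow_norm (by simp) (by simp), Real.sqrt_eq_rpow]
  simp

theorem tendsto_eLpNorm_two {α H : Type*} [MeasurableSpace α] {μ : Measure α}
    [NormedAddCommGroup H] {f : ℕ → α → H} (hf : ∀ k, MemLp (f k) 2 μ)
    (h : Tendsto (fun k => ∫ x, ‖f k x‖ ^ 2 ∂μ) atTop (𝓝 0)) :
    Tendsto (fun k => eLpNorm (f k) 2 μ) atTop (𝓝 0) := by
  simp only [fun k => eLpNorm_two_eq (hf k)]
  have := ENNReal.tendsto_ofReal ((Real.continuous_sqrt.tendsto 0).comp h)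
  simpa using this

/-- Almost everywhere convergence, together with a convergent sequence of dominating functions,
implies convergence in `L²`. -/
theorem tendsto_eLpNorm_two_of_tendsto_ae {α H : Type*} [MeasurableSpace α] {μ : Measure α}
    [NormedAddCommGroup H] {f : ℕ → α → H} {f₀ : α → H} {D : ℕ → α → ℝ}
    (hf : ∀ k, MemLp (f k) 2 μ) (hf₀ : MemLp f₀ 2 μ) (hD : ∀ k, Integrable (D k) μ)
    (hfD : ∀ k x, ‖f k x‖ ^ 2 ≤ D k x) (hDint : ∀ k, ∫ x, D k x ∂μ = ∫ x, ‖f₀ x‖ ^ 2 ∂μ)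
    (hDt : ∀ᵐ x ∂μ, Tendsto (fun k => D k x) atTop (𝓝 (‖f₀ x‖ ^ 2)))
    (hft : ∀ᵐ x ∂μ, Tendsto (fun k => f k x) atTop (𝓝 (f₀ x))) :
    Tendsto (fun k => eLpNorm (f k - f₀) 2 μ) atTop (𝓝 0) := by
  refine tendsto_eLpNorm_two (fun k => (hf k).sub hf₀) ?_
  have hI₀ : Integrable (fun x => ‖f₀ x‖ ^ 2) μ := hf₀.integrable_norm_pow (by simp)
  have hJ : ∀ k, Integrable (fun x => ‖(f k - f₀) x‖ ^ 2) μ := fun k =>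
    ((hf k).sub hf₀).integrable_norm_pow (by simp)
  set I := ∫ x, ‖f₀ x‖ ^ 2 ∂μ
  -- These functions are nonnegative and tend to 4|f₀|². Their integrals are 4I - ∫ |f_k - f₀|², so
  -- Fatou's lemma forces the last integral to zero.
  set F : ℕ → α → ℝ := fun k x => 2 * D k x + 2 * ‖f₀ x‖ ^ 2 - ‖(f k - f₀) x‖ ^ 2
  have hFi : ∀ k, Integrable (F k) μ := fun k =>
    (((hD k).const_mul 2).add (hI₀.const_mul 2)).sub (hJ k)
  have hF0 : ∀ k x, 0 ≤ F k x := fun k x => by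
    have h1 : ‖(f k - f₀) x‖ ≤ ‖f k x‖ + ‖f₀ x‖ := norm_sub_le _ _
    have h2 := hfD k x
    simp only [F]
    nlinarith [sq_nonneg (‖f k x‖ - ‖f₀ x‖), norm_nonneg ((f k - f₀) x)]
  have hFint : ∀ k, ∫ x, F k x ∂μ = 4 * I - ∫ x, ‖(f k - f₀) x‖ ^ 2 ∂μ := fun k => by
    have hs : Integrable (fun x => 2 * D k x + 2 * ‖f₀ x‖ ^ 2) μ :=
      ((hD k).const_mul 2).add (hI₀.const_mul 2)
    simp only [F]
    rw [integral_sub hs (hJ k), integral_add ((hD k).const_mul 2) (hI₀.const_mul 2),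
      integral_const_mul, integral_const_mul, hDint k]
    ring
  have hfat := lintegral_liminf_le' (μ := μ) (u := atTop) (f := fun k x => ENNReal.ofReal (F k x))
    (fun k => (hFi k).1.aemeasurable.ennreal_ofReal)
  have hlim : ∀ᵐ x ∂μ, liminf (fun k => ENNReal.ofReal (F k x)) atTop =
      ENNReal.ofReal (4 * ‖f₀ x‖ ^ 2) := by
    filter_upwards [hDt, hft] with x h1 h2
    refine Tendsto.liminf_eq (ENNReal.tendsto_ofReal ?_)
    have h3 := ((h1.const_mul 2).add_const (2 * ‖f₀ x‖ ^ 2)).sub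
      (((h2.sub_const (f₀ x)).norm).pow 2)
    convert h3 using 2
    · rfl
    · rw [sub_self, norm_zero]
      ring
  rw [lintegral_congr_ae hlim, ← ofReal_integral_eq_lintegral_ofReal (hI₀.const_mul 4)
    (Eventually.of_forall fun x => by positivity), integral_const_mul] at hfat
  simp only [fun k => (ofReal_integral_eq_lintegral_ofReal (hFi k)
    (Eventually.of_forall (hF0 k))).symm, hFint] at hfat
  rw [tendsto_order]
  refine ⟨fun a ha => Eventually.of_forall fun k =>
    ha.trans_le (integral_nonneg fun x => by positivity), fun ε hε => ?_⟩
  -- `ENNReal.ofReal` cuts off negative values, so the strict comparison below needs 4I - ε ≥ 0.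
  -- Otherwise ∫ F_k ≥ 0 already gives ∫ |f_k - f₀|² ≤ 4I < ε.
  by_cases hI : 4 * I - ε < 0
  · refine Eventually.of_forall fun k => ?_
    have : 0 ≤ ∫ x, F k x ∂μ := integral_nonneg fun x => hF0 k x
    rw [hFint k] at this
    linarith
  · have hlt : ENNReal.ofReal (4 * I - ε) <
        liminf (fun k => ENNReal.ofReal (4 * I - ∫ x, ‖(f k - f₀) x‖ ^ 2 ∂μ)) atTop := by
      refine lt_of_lt_of_le ?_ hfat
      rw [ENNReal.ofReal_lt_ofReal_iff (by linarith)]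
      linarith
    filter_upwards [eventually_lt_of_lt_liminf hlt] with k hk
    have := ENNReal.lt_ofReal_iff_toReal_lt (by simp) |>.1 hk
    rw [ENNReal.toReal_ofReal (by linarith)] at this
    linarith

/-! ### Mollification -/

section Mollify

variable {H : Type*} [NormedAddCommGroup H] [InnerProductSpace ℝ H] [CompleteSpace H]

/-- Jensen's inequality for the probability density `ρ.normed`, obtained by expanding the
nonnegative variance about the mean c. -/
theorem norm_sq_convolution_le (ρ : ContDiffBump (0 : Euc n)) {h : Euc n → H}
    (hi : Integrable h) (h2 : MemLp h 2 volume) (x : Euc n) :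
    ‖(ρ.normed volume ⋆[ContinuousLinearMap.lsmul ℝ ℝ, volume] h) x‖ ^ 2 ≤
      (ρ.normed volume ⋆[ContinuousLinearMap.lsmul ℝ ℝ, volume] fun y => ‖h y‖ ^ 2) x := by
  have hsq : Integrable (fun y => ‖h y‖ ^ 2) := h2.integrable_norm_pow (by simp)
  set r : Euc n → ℝ := ρ.normed volume
  have hr : Integrable r := ρ.integrable_normed
  have e1 : Integrable (fun t => r t • h (x - t)) :=
    (ρ.hasCompactSupport_normed.convolutionExists_left (ContinuousLinearMap.lsmul ℝ ℝ)
      ρ.continuous_normed hi.locallyIntegrable) x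
  have e2 : Integrable (fun t => r t * ‖h (x - t)‖ ^ 2) :=
    (ρ.hasCompactSupport_normed.convolutionExists_left (ContinuousLinearMap.lsmul ℝ ℝ)
      ρ.continuous_normed hsq.locallyIntegrable) x
  simp only [convolution_def, ContinuousLinearMap.lsmul_apply, smul_eq_mul]
  set c : H := ∫ t, r t • h (x - t)
  have h0 : 0 ≤ ∫ t, r t * ‖h (x - t) - c‖ ^ 2 :=
    integral_nonneg fun t => mul_nonneg (ρ.nonneg_normed t) (by positivity)
  have h1 : ∀ t, r t * ‖h (x - t) - c‖ ^ 2 =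
      r t * ‖h (x - t)‖ ^ 2 - 2 * inner ℝ c (r t • h (x - t)) + ‖c‖ ^ 2 * r t := fun t => by
    rw [norm_sub_sq_real, inner_smul_right, real_inner_comm]
    ring
  have e3 : Integrable (fun t => 2 * inner ℝ c (r t • h (x - t))) := (e1.const_inner c).const_mul 2
  have h4 : ∫ t, (r t * ‖h (x - t)‖ ^ 2 - 2 * inner ℝ c (r t • h (x - t)) + ‖c‖ ^ 2 * r t) =
      (∫ t, r t * ‖h (x - t)‖ ^ 2) - 2 * inner ℝ c c + ‖c‖ ^ 2 := by
    have hs : Integrable (fun t => r t * ‖h (x - t)‖ ^ 2 - 2 * inner ℝ c (r t • h (x - t))) :=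
      e2.sub e3
    rw [integral_add hs (hr.const_mul _), integral_sub e2 e3, integral_const_mul,
      integral_const_mul, integral_inner e1, ρ.integral_normed, mul_one]
  simp only [h1] at h0
  rw [h4, real_inner_self_eq_norm_sq] at h0
  linarith

/-- Convergence almost everywhere is Lebesgue differentiation, for which the ratio of outer to inner
radius must stay bounded. It improves to L² because |ρ_k ⋆ h|² ≤ ρ_k ⋆ |h|², and all these
dominating functions have the integral of |h|². -/
theorem tendsto_convolution {ρ : ℕ → ContDiffBump (0 : Euc n)}
    (hρ : Tendsto (fun k => (ρ k).rOut) atTop (𝓝 0)) {K : ℝ}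
    (hρK : ∀ k, (ρ k).rOut ≤ K * (ρ k).rIn) {h : Euc n → H}
    (hi : Integrable h) (h2 : MemLp h 2 volume) :
    (∀ᵐ x, Tendsto (fun k =>
      ((ρ k).normed volume ⋆[ContinuousLinearMap.lsmul ℝ ℝ, volume] h) x) atTop (𝓝 (h x))) ∧
    (∀ k, MemLp ((ρ k).normed volume ⋆[ContinuousLinearMap.lsmul ℝ ℝ, volume] h) 2 volume) ∧
    Tendsto (fun k => eLpNorm
      (((ρ k).normed volume ⋆[ContinuousLinearMap.lsmul ℝ ℝ, volume] h) - h) 2 volume)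
      atTop (𝓝 0) := by
  have hsq : Integrable (fun y => ‖h y‖ ^ 2) := h2.integrable_norm_pow (by simp)
  have hae := ContDiffBump.ae_convolution_tendsto_right_of_locallyIntegrable hρ
    (Eventually.of_forall hρK) hi.locallyIntegrable
  have hae2 := ContDiffBump.ae_convolution_tendsto_right_of_locallyIntegrable hρ
    (Eventually.of_forall hρK) hsq.locallyIntegrable
  have hD : ∀ k, Integrable
      ((ρ k).normed volume ⋆[ContinuousLinearMap.lsmul ℝ ℝ, volume] fun y => ‖h y‖ ^ 2) :=
    fun k => Integrable.integrable_convolution _ (ρ k).integrable_normed hsq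
  have hle : ∀ k x, _ := fun k x => norm_sq_convolution_le (ρ k) hi h2 x
  have hmem : ∀ k,
      MemLp ((ρ k).normed volume ⋆[ContinuousLinearMap.lsmul ℝ ℝ, volume] h) 2 volume := by
    intro k
    have hm : AEStronglyMeasurable
        ((ρ k).normed volume ⋆[ContinuousLinearMap.lsmul ℝ ℝ, volume] h) volume :=
      (Integrable.integrable_convolution _ (ρ k).integrable_normed hi).1
    rw [memLp_two_iff_integrable_sq_norm hm]
    refine (hD k).mono' (hm.norm.pow 2) (Eventually.of_forall fun x => ?_)
    rw [Real.norm_of_nonneg (by positivity)]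
    exact hle k x
  refine ⟨hae, hmem, tendsto_eLpNorm_two_of_tendsto_ae hmem h2 hD hle (fun k => ?_) hae2 hae⟩
  rw [integral_convolution _ (ρ k).integrable_normed hsq, (ρ k).integral_normed]
  simp

end Mollify

/-! ### Smooth approximation of Sobolev functions -/

/-- The smooth functions `w k` approximate `v`, with weak gradient `g`, in `H¹(B_R(x₀))` and almost
everywhere. -/
structure SmoothApprox (x₀ : Euc n) (R : ℝ) (v : Euc n → ℝ) (g : Euc n → Euc n)
    (w : ℕ → Euc n → ℝ) : Prop where
  contDiff : ∀ k, ContDiff ℝ ∞ (w k)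
  ae_tendsto : ∀ᵐ x ∂(volume.restrict (ball x₀ R)), Tendsto (fun k => w k x) atTop (𝓝 (v x))
  tendsto : Tendsto (fun k => eLpNorm (w k - v) 2 (volume.restrict (ball x₀ R))) atTop (𝓝 0)
  tendsto_grad : Tendsto (fun k => eLpNorm (gradient (w k) - g) 2
    (volume.restrict (ball x₀ R))) atTop (𝓝 0)

theorem MemL2Loc.memLp_ball {X : Type*} [NormedAddCommGroup X] {x₀ : Euc n} {δ R : ℝ}
    {v : Euc n → X} (h : MemL2Loc (ball x₀ δ) v) (hR : R < δ) :
    MemLp v 2 (volume.restrict (ball x₀ R)) :=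
  (h _ (closedBall_subset_ball hR) (isCompact_closedBall x₀ R)).mono_measure
    (Measure.restrict_mono ball_subset_closedBall le_rfl)

theorem fderiv_convolution_apply {r h : Euc n → ℝ} (hrs : ContDiff ℝ ∞ r)
    (hrc : HasCompactSupport r) (hi : LocallyIntegrable h) (x e : Euc n) :
    fderiv ℝ (r ⋆[ContinuousLinearMap.lsmul ℝ ℝ, volume] h) x e =
      ∫ y, fderiv ℝ r (x - y) e * h y := by
  have h1 := (hrc.hasFDerivAt_convolution_left (ContinuousLinearMap.lsmul ℝ ℝ)
    (hrs.of_le (by simp)) hi x).fderiv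
  rw [h1]
  have hex := (hrc.fderiv (𝕜 := ℝ)).convolutionExists_left
      (ContinuousLinearMap.precompL (Euc n) (ContinuousLinearMap.lsmul ℝ ℝ))
      (hrs.continuous_fderiv (by simp)) hi x
  rw [convolution_def, ContinuousLinearMap.integral_apply hex]
  have hv := integral_sub_left_eq_self (fun y => fderiv ℝ r (x - y) e * h y) volume x
  simp only [sub_sub_cancel] at hv
  rw [← hv]
  rfl

theorem inner_convolution {r : Euc n → ℝ} {g : Euc n → Euc n} (hrs : Continuous r)
    (hrc : HasCompactSupport r) (hi : LocallyIntegrable g) (x e : Euc n) :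
    inner ℝ ((r ⋆[ContinuousLinearMap.lsmul ℝ ℝ, volume] g) x) e =
      ∫ y, r (x - y) * inner ℝ (g y) e := by
  have hex := hrc.convolutionExists_left (ContinuousLinearMap.lsmul ℝ ℝ) hrs hi x
  have hex2 : Integrable fun t => r t • g (x - t) := hex
  have hL : (r ⋆[ContinuousLinearMap.lsmul ℝ ℝ, volume] g) x = ∫ t, r t • g (x - t) := rfl
  rw [hL, real_inner_comm, ← integral_inner hex2,
    ← integral_sub_left_eq_self (fun y => r (x - y) * inner ℝ (g y) e) volume x]
  refine integral_congr_ae (Eventually.of_forall fun t => ?_)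
  simp only [sub_sub_cancel, inner_smul_right]
  rw [real_inner_comm]

/-- The weak gradient is tested with y ↦ r(x - y). The support of this function lies in the closed
ball of radius R', so truncating `v` and `g` there does not affect the value at x. -/
theorem IsWeakGradient.gradient_convolution {x₀ : Euc n} {δ R' : ℝ} {v : Euc n → ℝ}
    {g : Euc n → Euc n} (h : IsWeakGradient (ball x₀ δ) v g) (hR' : R' < δ)
    {r : Euc n → ℝ} {c : ℝ} (hrs : ContDiff ℝ ∞ r) (hrt : tsupport r ⊆ closedBall 0 c)
    {x : Euc n} (hx : closedBall x c ⊆ closedBall x₀ R') :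
    gradient (r ⋆[ContinuousLinearMap.lsmul ℝ ℝ, volume]
      (closedBall x₀ R').indicator v) x =
    (r ⋆[ContinuousLinearMap.lsmul ℝ ℝ, volume] (closedBall x₀ R').indicator g) x := by
  have hsub : closedBall x₀ R' ⊆ ball x₀ δ := closedBall_subset_ball hR'
  have hiv : Integrable ((closedBall x₀ R').indicator v) :=
    (h.locallyIntegrable.integrableOn_compact_subset hsub
      (isCompact_closedBall _ _)).integrable_indicator measurableSet_closedBall
  have hig : Integrable ((closedBall x₀ R').indicator g) :=
    (h.locallyIntegrable_grad.integrableOn_compact_subset hsub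
      (isCompact_closedBall _ _)).integrable_indicator measurableSet_closedBall
  have hrc : HasCompactSupport r :=
    (isCompact_closedBall 0 c).of_isClosed_subset (isClosed_tsupport _) hrt
  have hr0 : ∀ y, y ∉ closedBall x c → x - y ∉ tsupport r := by
    intro y hy hy'
    exact hy (by rw [mem_closedBall_iff_norm']; exact mem_closedBall_zero_iff.1 (hrt hy'))
  set φ : Euc n → ℝ := fun y => r (x - y)
  have hφs : ContDiff ℝ ∞ φ := hrs.comp (contDiff_const.sub contDiff_id)
  have hφt : tsupport φ ⊆ closedBall x c := by
    refine closure_minimal (fun y hy => ?_) isClosed_closedBall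
    by_contra hcon
    exact hy (image_eq_zero_of_notMem_tsupport (f := r) (hr0 y hcon))
  have hφc : HasCompactSupport φ :=
    (isCompact_closedBall x c).of_isClosed_subset (isClosed_tsupport _) hφt
  have hφd : ∀ y e, fderiv ℝ φ y e = -(fderiv ℝ r (x - y) e) := by
    intro y e
    have h1 : HasFDerivAt (fun y : Euc n => x - y) (-ContinuousLinearMap.id ℝ (Euc n)) y :=
      (hasFDerivAt_id y).const_sub x
    have h2 := ((hrs.differentiable (by simp) (x - y)).hasFDerivAt.comp y h1).fderiv
    have h3 : fderiv ℝ φ y = _ := h2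
    rw [h3]
    simp
  refine ext_inner_right ℝ fun e => ?_
  rw [inner_gradient_left, fderiv_convolution_apply hrs hrc hiv.locallyIntegrable,
    inner_convolution hrs.continuous hrc hig.locallyIntegrable]
  have hw := h.integral_eq φ hφs hφc (hφt.trans (hx.trans hsub)) e
  rw [setIntegral_eq_integral_of_forall_compl_eq_zero,
    setIntegral_eq_integral_of_forall_compl_eq_zero] at hw
  · have e1 : ∫ y, fderiv ℝ r (x - y) e * (closedBall x₀ R').indicator v y =
        -∫ y, v y * fderiv ℝ φ y e := by
      rw [← integral_neg]
      refine integral_congr_ae (Eventually.of_forall fun y => ?_)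
      simp only [hφd]
      by_cases hy : y ∈ closedBall x₀ R'
      · rw [indicator_of_mem hy]; ring
      · rw [(notMem_tsupport_iff_eventuallyEq.1 (hr0 y (mt (@hx y) hy))).fderiv_eq]
        simp
    rw [e1, hw, neg_neg]
    refine integral_congr_ae (Eventually.of_forall fun y => ?_)
    simp only
    by_cases hy : y ∈ closedBall x₀ R'
    · rw [indicator_of_mem hy, mul_comm]
    · have : r (x - y) = 0 := image_eq_zero_of_notMem_tsupport (hr0 y (mt (@hx y) hy))
      simp [φ, this]
  · intro y hy
    have : φ y = 0 := image_eq_zero_of_notMem_tsupport fun hy' => hy (hsub (hx (hφt hy')))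
    rw [this, mul_zero]
  · intro y hy
    rw [(notMem_tsupport_iff_eventuallyEq.1 fun hy' => hy (hsub (hx (hφt hy')))).fderiv_eq]
    simp

theorem IsH1Loc.exists_smoothApprox {x₀ : Euc n} {δ R : ℝ} {v : Euc n → ℝ}
    {g : Euc n → Euc n} (h : IsH1Loc (ball x₀ δ) v g) (hR : R < δ) :
    ∃ w, SmoothApprox x₀ R v g w := by
  set R' := (R + δ) / 2
  have hR' : R' < δ := by simp only [R']; linarith
  -- R + c = R', so mollifying at scale at most c at a point of B_R sees only the closed ball of
  -- radius R'.
  set c := (δ - R) / 2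
  have hc : 0 < c := by simp only [c]; linarith
  let ρ : ℕ → ContDiffBump (0 : Euc n) := fun k =>
    ⟨c / (2 * (k + 1)), c / (k + 1), by positivity, by
      apply div_lt_div_of_pos_left hc <;> linarith [(Nat.cast_nonneg k : (0 : ℝ) ≤ k)]⟩
  have hρ : Tendsto (fun k => (ρ k).rOut) atTop (𝓝 0) := by
    have := (tendsto_one_div_add_atTop_nhds_zero_nat (𝕜 := ℝ)).const_mul c
    simpa [ρ, div_eq_mul_inv] using this
  have hρK : ∀ k, (ρ k).rOut ≤ 2 * (ρ k).rIn := fun k => by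
    simp only [ρ]
    field_simp
    exact le_rfl
  have hρc : ∀ k, (ρ k).rOut ≤ c := fun k => by
    simp only [ρ]
    exact div_le_self hc.le (by linarith [(Nat.cast_nonneg k : (0 : ℝ) ≤ k)])
  have hmem : ∀ {X : Type} [NormedAddCommGroup X] [NormedSpace ℝ X] {f : Euc n → X},
      MemL2Loc (ball x₀ δ) f → MemLp ((closedBall x₀ R').indicator f) 2 volume := fun hf => by
    rw [memLp_indicator_iff_restrict measurableSet_closedBall]
    exact hf _ (closedBall_subset_ball hR') (isCompact_closedBall _ _)
  have hint : ∀ {X : Type} [NormedAddCommGroup X] {f : Euc n → X},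
      LocallyIntegrableOn f (ball x₀ δ) → Integrable ((closedBall x₀ R').indicator f) := fun hf =>
    (hf.integrableOn_compact_subset (closedBall_subset_ball hR')
      (isCompact_closedBall _ _)).integrable_indicator measurableSet_closedBall
  have hiv := hint h.weakGradient.locallyIntegrable
  obtain ⟨a1, -, a3⟩ := tendsto_convolution hρ hρK hiv (hmem h.memL2Loc)
  obtain ⟨-, -, b3⟩ := tendsto_convolution hρ hρK
    (hint h.weakGradient.locallyIntegrable_grad) (hmem h.memL2Loc_grad)
  have hsub : ∀ x ∈ ball x₀ R, x ∈ closedBall x₀ R' := fun x hx =>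
    (ball_subset_closedBall.trans (closedBall_subset_closedBall
      (by simp only [R']; linarith))) hx
  refine ⟨fun k => (ρ k).normed volume ⋆[ContinuousLinearMap.lsmul ℝ ℝ, volume]
    (closedBall x₀ R').indicator v, ⟨fun k => ?_, ?_, ?_, ?_⟩⟩
  · exact (ρ k).hasCompactSupport_normed.contDiff_convolution_left _ (ρ k).contDiff_normed
      hiv.locallyIntegrable
  · rw [ae_restrict_iff' measurableSet_ball]
    filter_upwards [a1] with x hx hxR
    rwa [indicator_of_mem (hsub x hxR)] at hx
  · refine tendsto_of_tendsto_of_tendsto_of_le_of_le tendsto_const_nhds a3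
      (fun _ => zero_le) fun k => ?_
    refine le_trans (le_of_eq ?_)
      (eLpNorm_mono_measure _ (Measure.restrict_le_self (s := ball x₀ R)))
    refine eLpNorm_congr_ae ?_
    filter_upwards [ae_restrict_mem measurableSet_ball] with x hx
    simp only [Pi.sub_apply]
    rw [indicator_of_mem (hsub x hx)]
  · refine tendsto_of_tendsto_of_tendsto_of_le_of_le tendsto_const_nhds b3
      (fun _ => zero_le) fun k => ?_
    refine le_trans (le_of_eq ?_)
      (eLpNorm_mono_measure _ (Measure.restrict_le_self (s := ball x₀ R)))
    refine eLpNorm_congr_ae ?_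
    filter_upwards [ae_restrict_mem measurableSet_ball] with x hx
    simp only [Pi.sub_apply]
    rw [h.weakGradient.gradient_convolution hR' (ρ k).contDiff_normed
      (ρ k).tsupport_normed_eq.subset, indicator_of_mem (hsub x hx)]
    refine closedBall_subset_closedBall' ?_
    have h1 := hρc k
    have h2 := mem_ball.1 hx
    simp only [c] at h1
    simp only [R']
    linarith

/-! ### Traces on spheres -/

theorem continuous_gradient {w : Euc n → ℝ} (hw : ContDiff ℝ 1 w) : Continuous (gradient w) := by
  unfold gradient
  exact (LinearIsometryEquiv.continuous _).comp (hw.continuous_fderiv (by simp))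

theorem gradient_sub {w w' : Euc n → ℝ} (hw : Differentiable ℝ w) (hw' : Differentiable ℝ w') :
    gradient (w - w') = gradient w - gradient w' := by
  ext1 x
  refine ext_inner_right ℝ fun e => ?_
  rw [inner_gradient_left, fderiv_sub (hw x) (hw' x), Pi.sub_apply, inner_sub_left,
    inner_gradient_left, inner_gradient_left]
  rfl

instance isFiniteMeasure_restrict_ball (x₀ : Euc n) (r : ℝ) :
    IsFiniteMeasure (volume.restrict (ball x₀ r)) :=
  ⟨by simp [measure_ball_lt_top]⟩

theorem integrable_mul_of_memLp {α : Type*} [MeasurableSpace α] {μ : Measure α}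
    {a b : α → ℝ} (ha : MemLp a 2 μ) (hb : MemLp b 2 μ) : Integrable (fun x => a x * b x) μ :=
  ha.integrable_mul hb

theorem integrable_inner_of_memLp {α H : Type*} [MeasurableSpace α] {μ : Measure α}
    [NormedAddCommGroup H] [InnerProductSpace ℝ H] {a b : α → H} (ha : MemLp a 2 μ)
    (hb : MemLp b 2 μ) : Integrable (fun x => inner ℝ (a x) (b x)) μ :=
  (integrable_mul_of_memLp ha.norm hb.norm).mono' (ha.1.inner hb.1)
    (Eventually.of_forall fun _ => norm_inner_le_norm _ _)

theorem memLp_ball_of_continuous {X : Type*} [NormedAddCommGroup X] {f : Euc n → X}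
    (hf : Continuous f) (x₀ : Euc n) (r : ℝ) (p : ENNReal) :
    MemLp f p (volume.restrict (ball x₀ r)) := by
  obtain ⟨C, hC⟩ := (isCompact_closedBall x₀ r).exists_bound_of_continuousOn hf.continuousOn
  refine MemLp.of_bound hf.aestronglyMeasurable C ?_
  filter_upwards [ae_restrict_mem measurableSet_ball] with x hx
  exact hC x (ball_subset_closedBall hx)

theorem memLp_sphere_of_continuous {X : Type*} [NormedAddCommGroup X] {f : Euc n → X}
    (hf : Continuous f) (x₀ : Euc n) {r : ℝ} (hr : 0 < r) (p : ENNReal) :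
    MemLp f p (sphereMeasure x₀ r) := by
  obtain ⟨C, hC⟩ := (isCompact_closedBall x₀ r).exists_bound_of_continuousOn hf.continuousOn
  refine MemLp.of_bound hf.aestronglyMeasurable C ?_
  filter_upwards [ae_norm_sub_eq x₀ hr] with x hx
  exact hC x (mem_closedBall_iff_norm.2 hx.le)

theorem continuous_sphereNormal (x₀ : Euc n) (r : ℝ) : Continuous (sphereNormal x₀ r) := by
  unfold sphereNormal
  fun_prop

theorem gaussGreen_of_contDiff [NeZero n] (x₀ : Euc n) {r : ℝ} (hr : 0 < r) {w : Euc n → ℝ}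
    {φ : Euc n → Euc n} (hw : ContDiff ℝ 1 w) (hφ : ContDiff ℝ 1 φ) :
    ∫ x in ball x₀ r, (w x * divergence φ x + inner ℝ (gradient w x) (φ x))
      = ∫ x, w x * inner ℝ (φ x) (sphereNormal x₀ r x) ∂(sphereMeasure x₀ r) := by
  have h := integral_ball_divergence x₀ (hw.smul hφ) hr
  have e1 : ∀ x, divergence (w • φ) x = w x * divergence φ x + inner ℝ (gradient w x) (φ x) :=
    fun x => by
      rw [inner_gradient_left]
      exact divergence_smul (hw.differentiable (by simp) x) (hφ.differentiable (by simp) x)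
  have e2 : ∀ x, inner ℝ ((w • φ) x) (sphereNormal x₀ r x) =
      w x * inner ℝ (φ x) (sphereNormal x₀ r x) := fun x => by
    rw [Pi.smul_apply', real_inner_smul_left]
  simpa only [e1, e2] using h

/-- Gauss–Green for w against the field w (x - x₀), using (x - x₀)·ν = r on the sphere. -/
theorem mul_integral_sphere_sq [NeZero n] (x₀ : Euc n) {r : ℝ} (hr : 0 < r) {w : Euc n → ℝ}
    (hw : ContDiff ℝ 1 w) :
    r * ∫ x, w x ^ 2 ∂(sphereMeasure x₀ r)
      = ∫ x in ball x₀ r, (n * w x ^ 2 + 2 * (w x * inner ℝ (gradient w x) (x - x₀))) := by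
  have hid : ContDiff ℝ 1 fun x : Euc n => x - x₀ := contDiff_id.sub contDiff_const
  have h := gaussGreen_of_contDiff x₀ hr hw (hw.smul hid)
  have e1 : ∀ x, w x * divergence (w • fun y => y - x₀) x +
      inner ℝ (gradient w x) ((w • fun y => y - x₀) x) =
      n * w x ^ 2 + 2 * (w x * inner ℝ (gradient w x) (x - x₀)) := fun x => by
    have h1 : divergence (w • fun y => y - x₀) x = _ :=
      divergence_smul (hw.differentiable (by simp) x) (hid.differentiable (by simp) x)
    rw [h1, divergence_sub_const, Pi.smul_apply', real_inner_smul_right, inner_gradient_left]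
    ring
  have h' : ∫ x in ball x₀ r, (n * w x ^ 2 + 2 * (w x * inner ℝ (gradient w x) (x - x₀))) =
    ∫ x, w x * inner ℝ ((w • fun y => y - x₀) x) (sphereNormal x₀ r x) ∂(sphereMeasure x₀ r) := by
    rw [← h]
    exact integral_congr_ae (Eventually.of_forall fun x => (e1 x).symm)
  rw [h', ← integral_const_mul]
  refine integral_sphereMeasure_congr x₀ hr fun x hx => ?_
  rw [Pi.smul_apply', real_inner_smul_left, sphereNormal, real_inner_smul_right,
    real_inner_self_eq_norm_sq, hx]
  field_simp

/-- The trace inequality. The constant comes from n w² + 2r|w||∇w| ≤ (n + r)(w² + |∇w|²) in the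
preceding identity, divided by r. -/
theorem exists_eLpNorm_sphere_le [NeZero n] (x₀ : Euc n) {r : ℝ} (hr : 0 < r) :
    ∃ C : ENNReal, C ≠ ⊤ ∧ ∀ w : Euc n → ℝ, ContDiff ℝ 1 w →
      eLpNorm w 2 (sphereMeasure x₀ r) ≤
        C * (eLpNorm w 2 (volume.restrict (ball x₀ r)) +
          eLpNorm (gradient w) 2 (volume.restrict (ball x₀ r))) := by
  refine ⟨ENNReal.ofReal (√((n + r) / r)), ENNReal.ofReal_ne_top, fun w hw => ?_⟩
  have hwc := hw.continuous
  have hgc := continuous_gradient hw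
  have m1 := memLp_ball_of_continuous hwc x₀ r 2
  have m2 := memLp_ball_of_continuous hgc x₀ r 2
  rw [eLpNorm_two_eq (memLp_sphere_of_continuous hwc x₀ hr 2), eLpNorm_two_eq m1,
    eLpNorm_two_eq m2, ← ENNReal.ofReal_add (by positivity) (by positivity),
    ← ENNReal.ofReal_mul (by positivity)]
  refine ENNReal.ofReal_le_ofReal ?_
  have i1 : IntegrableOn (fun x => ‖w x‖ ^ 2) (ball x₀ r) := m1.integrable_norm_pow (by simp)
  have i2 : IntegrableOn (fun x => ‖gradient w x‖ ^ 2) (ball x₀ r) :=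
    m2.integrable_norm_pow (by simp)
  set a := ∫ x in ball x₀ r, ‖w x‖ ^ 2
  set b := ∫ x in ball x₀ r, ‖gradient w x‖ ^ 2
  have ha : 0 ≤ a := integral_nonneg fun x => by positivity
  have hb : 0 ≤ b := integral_nonneg fun x => by positivity
  have hmain : r * ∫ x, ‖w x‖ ^ 2 ∂(sphereMeasure x₀ r) ≤ (n + r) * (a + b) := by
    simp only [Real.norm_eq_abs, sq_abs]
    rw [mul_integral_sphere_sq x₀ hr hw, ← integral_add i1 i2, ← integral_const_mul]
    refine setIntegral_mono_on ?_ ((i1.add i2).const_mul _) measurableSet_ball fun x hx => ?_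
    · refine (memLp_ball_of_continuous ?_ x₀ r 1).integrable le_rfl
      fun_prop
    · have h1 : ‖x - x₀‖ ≤ r := (mem_ball_iff_norm.1 hx).le
      have h2 : |inner ℝ (gradient w x) (x - x₀)| ≤ ‖gradient w x‖ * r :=
        (abs_real_inner_le_norm _ _).trans (by gcongr)
      have h3 : w x * inner ℝ (gradient w x) (x - x₀) ≤ ‖w x‖ * (‖gradient w x‖ * r) := by
        refine (le_abs_self _).trans ?_
        rw [abs_mul, Real.norm_eq_abs]
        gcongr
      have h4 : w x ^ 2 = ‖w x‖ ^ 2 := by simp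
      rw [h4]
      have h5 : (0 : ℝ) ≤ n := Nat.cast_nonneg n
      nlinarith [sq_nonneg (‖w x‖ - ‖gradient w x‖), mul_nonneg h5 (sq_nonneg ‖gradient w x‖)]
  have hsq : √((n + r) / r) * (√a + √b) ≥ √((n + r) / r) * √(a + b) := by
    gcongr
    rw [Real.sqrt_le_left (by positivity)]
    nlinarith [Real.sq_sqrt ha, Real.sq_sqrt hb, Real.sqrt_nonneg a, Real.sqrt_nonneg b,
      mul_nonneg (Real.sqrt_nonneg a) (Real.sqrt_nonneg b)]
  refine le_trans ?_ hsq
  rw [← Real.sqrt_mul (by positivity)]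
  refine Real.sqrt_le_sqrt ?_
  rw [div_mul_eq_mul_div, le_div_iff₀ hr]
  linarith

theorem SmoothApprox.mono {x₀ : Euc n} {R R' : ℝ} {v : Euc n → ℝ} {g : Euc n → Euc n}
    {w : ℕ → Euc n → ℝ} (h : SmoothApprox x₀ R v g w) (hR : R' ≤ R) :
    SmoothApprox x₀ R' v g w := by
  have hle : volume.restrict (ball x₀ R') ≤ volume.restrict (ball x₀ R) :=
    Measure.restrict_mono (ball_subset_ball hR) le_rfl
  exact ⟨h.contDiff, ae_mono hle h.ae_tendsto,
    tendsto_of_tendsto_of_tendsto_of_le_of_le tendsto_const_nhds h.tendsto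
      (fun _ => zero_le) fun k => eLpNorm_mono_measure _ hle,
    tendsto_of_tendsto_of_tendsto_of_le_of_le tendsto_const_nhds h.tendsto_grad
      (fun _ => zero_le) fun k => eLpNorm_mono_measure _ hle⟩

theorem eLpNorm_sub_le_add {α X : Type*} [MeasurableSpace α] {μ : Measure α}
    [NormedAddCommGroup X] {a b c : α → X} (ha : AEStronglyMeasurable a μ)
    (hb : AEStronglyMeasurable b μ) (hc : AEStronglyMeasurable c μ) :
    eLpNorm (a - b) 2 μ ≤ eLpNorm (a - c) 2 μ + eLpNorm (b - c) 2 μ := by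
  have h := eLpNorm_sub_le (ha.sub hc) (hb.sub hc) (p := 2) (by norm_num)
  simpa using h

/-- The trace inequality applied to differences makes the restrictions Cauchy in L² of the sphere,
which is complete. -/
theorem SmoothApprox.exists_tendsto_sphere [NeZero n] {x₀ : Euc n} {r : ℝ} {v : Euc n → ℝ}
    {g : Euc n → Euc n} {w : ℕ → Euc n → ℝ} (h : SmoothApprox x₀ r v g w) (hr : 0 < r)
    (hv : MemLp v 2 (volume.restrict (ball x₀ r)))
    (hg : MemLp g 2 (volume.restrict (ball x₀ r))) :
    ∃ T, MemLp T 2 (sphereMeasure x₀ r) ∧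
      Tendsto (fun k => eLpNorm (w k - T) 2 (sphereMeasure x₀ r)) atTop (𝓝 0) := by
  obtain ⟨C, hC, hle⟩ := exists_eLpNorm_sphere_le x₀ hr
  have hw : ∀ k, ContDiff ℝ 1 (w k) := fun k => (h.contDiff k).of_le (by simp)
  have hm : ∀ k, MemLp (w k) 2 (sphereMeasure x₀ r) := fun k =>
    memLp_sphere_of_continuous (hw k).continuous x₀ hr 2
  set ε : ℕ → ENNReal := fun k => eLpNorm (w k - v) 2 (volume.restrict (ball x₀ r)) +
    eLpNorm (gradient (w k) - g) 2 (volume.restrict (ball x₀ r))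
  have hε : Tendsto (fun k => C * ε k) atTop (𝓝 0) := by
    have := ENNReal.Tendsto.const_mul (a := C) (h.tendsto.add h.tendsto_grad) (Or.inr hC)
    simpa using this
  have hdist : ∀ k l, edist ((hm k).toLp (w k)) ((hm l).toLp (w l)) ≤ C * ε k + C * ε l := by
    intro k l
    rw [Lp.edist_toLp_toLp, ← mul_add]
    refine (hle _ ((hw k).sub (hw l))).trans (mul_le_mul' le_rfl ?_)
    have h1 := eLpNorm_sub_le_add ((hw k).continuous.aestronglyMeasurable)
      ((hw l).continuous.aestronglyMeasurable) hv.1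
    have h2 := eLpNorm_sub_le_add ((continuous_gradient (hw k)).aestronglyMeasurable)
      ((continuous_gradient (hw l)).aestronglyMeasurable) hg.1
    rw [← gradient_sub ((hw k).differentiable (by simp)) ((hw l).differentiable (by simp))] at h2
    refine (add_le_add h1 h2).trans (le_of_eq ?_)
    simp only [ε]
    ring
  have hcau : CauchySeq fun k => (hm k).toLp (w k) := by
    rw [EMetric.cauchySeq_iff]
    intro η hη
    have hev : ∀ᶠ k in atTop, C * ε k < η / 2 :=
      hε.eventually_lt_const (ENNReal.half_pos hη.ne')
    obtain ⟨N, hN⟩ := eventually_atTop.1 hev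
    refine ⟨N, fun k hk l hl => (hdist k l).trans_lt ?_⟩
    calc _ < η / 2 + η / 2 := ENNReal.add_lt_add (hN k hk) (hN l hl)
      _ = η := ENNReal.add_halves η
  obtain ⟨T, hT⟩ := cauchySeq_tendsto_of_complete hcau
  refine ⟨T, Lp.memLp T, ?_⟩
  rw [← Lp.tendsto_Lp_iff_tendsto_eLpNorm'' w hm T (Lp.memLp T)]
  simpa using hT

theorem tendsto_eLpNorm_sub_self {α X : Type*} [MeasurableSpace α] {μ : Measure α}
    [NormedAddCommGroup X] (q : α → X) :
    Tendsto (fun _ : ℕ => eLpNorm (q - q) 2 μ) atTop (𝓝 0) := by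
  simp

theorem SmoothApprox.isSphereTrace [NeZero n] {x₀ : Euc n} {r : ℝ} {v : Euc n → ℝ}
    {g : Euc n → Euc n} {w : ℕ → Euc n → ℝ} (h : SmoothApprox x₀ r v g w) (hr : 0 < r)
    (hv : MemLp v 2 (volume.restrict (ball x₀ r)))
    (hg : MemLp g 2 (volume.restrict (ball x₀ r))) {T : Euc n → ℝ}
    (hT : MemLp T 2 (sphereMeasure x₀ r))
    (hwT : Tendsto (fun k => eLpNorm (w k - T) 2 (sphereMeasure x₀ r)) atTop (𝓝 0)) :
    IsSphereTrace x₀ r v g T := by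
  refine ⟨hT, fun φ hφ => ?_⟩
  have hφ1 : ContDiff ℝ 1 φ := hφ.of_le (by simp)
  have hw : ∀ k, ContDiff ℝ 1 (w k) := fun k => (h.contDiff k).of_le (by simp)
  have m1 : ∀ k, MemLp (w k) 2 (volume.restrict (ball x₀ r)) := fun k =>
    memLp_ball_of_continuous (hw k).continuous x₀ r 2
  have m2 : ∀ k, MemLp (gradient (w k)) 2 (volume.restrict (ball x₀ r)) := fun k =>
    memLp_ball_of_continuous (continuous_gradient (hw k)) x₀ r 2
  have md := memLp_ball_of_continuous (continuous_divergence hφ1) x₀ r 2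
  have mφ := memLp_ball_of_continuous hφ.continuous x₀ r 2
  have mν : MemLp (fun x => inner ℝ (φ x) (sphereNormal x₀ r x)) 2 (sphereMeasure x₀ r) :=
    memLp_sphere_of_continuous (hφ.continuous.inner (continuous_sphereNormal x₀ r)) x₀ hr 2
  have t1 := tendsto_integral_mul m1 (fun _ => md) hv md h.tendsto (tendsto_eLpNorm_sub_self _)
  have t2 := tendsto_integral_inner m2 (fun _ => mφ) hg mφ h.tendsto_grad
    (tendsto_eLpNorm_sub_self _)
  have t3 := tendsto_integral_mul
    (fun k => memLp_sphere_of_continuous (hw k).continuous x₀ hr 2) (fun _ => mν) hT mν hwT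
    (tendsto_eLpNorm_sub_self _)
  rw [integral_add (integrable_mul_of_memLp hv md) (integrable_inner_of_memLp hg mφ)]
  refine tendsto_nhds_unique (t1.add t2) (t3.congr fun k => ?_)
  rw [← integral_add (integrable_mul_of_memLp (m1 k) md) (integrable_inner_of_memLp (m2 k) mφ)]
  exact (gaussGreen_of_contDiff x₀ hr (hw k) hφ1).symm

/-- Testing with ζν, where ν is extended to the smooth field (x - x₀)/r, isolates ∫ ζT because |ν| =
1 on the sphere. -/
theorem IsSphereTrace.ae_eq {x₀ : Euc n} {r : ℝ} (hr : 0 < r) {v : Euc n → ℝ}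
    {g : Euc n → Euc n} {T T' : Euc n → ℝ} (h : IsSphereTrace x₀ r v g T)
    (h' : IsSphereTrace x₀ r v g T') : T =ᵐ[sphereMeasure x₀ r] T' := by
  have hi := (h.memLp.sub h'.memLp).integrable (by norm_num)
  have key := ae_eq_zero_of_integral_contDiff_smul_eq_zero (μ := sphereMeasure x₀ r)
    hi.locallyIntegrable (fun ζ hζ hζc => by
      have hφ : ContDiff ℝ ∞ fun x => ζ x • sphereNormal x₀ r x :=
        hζ.smul (by unfold sphereNormal; fun_prop)
      have e := (h.gaussGreen _ hφ).symm.trans (h'.gaussGreen _ hφ)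
      have hs : ∀ S : Euc n → ℝ, ∫ x, S x * inner ℝ (ζ x • sphereNormal x₀ r x)
          (sphereNormal x₀ r x) ∂(sphereMeasure x₀ r) =
          ∫ x, ζ x * S x ∂(sphereMeasure x₀ r) := fun S =>
        integral_sphereMeasure_congr x₀ hr fun x hx => by
          rw [real_inner_smul_left, real_inner_self_eq_norm_sq, norm_sphereNormal x₀ hr hx]
          ring
      rw [hs, hs] at e
      have mζ := memLp_sphere_of_continuous hζ.continuous x₀ hr 2
      simp only [Pi.sub_apply, smul_eq_mul, mul_sub]
      rw [integral_sub (integrable_mul_of_memLp mζ h.memLp)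
        (integrable_mul_of_memLp mζ h'.memLp), e, sub_self])
  filter_upwards [key] with x hx
  simpa [sub_eq_zero] using hx

theorem IsH1Loc.memLp {x₀ : Euc n} {δ r : ℝ} {v : Euc n → ℝ}
    {g : Euc n → Euc n} (h : IsH1Loc (ball x₀ δ) v g) (hr : r < δ) :
    MemLp v 2 (volume.restrict (ball x₀ r)) :=
  h.memL2Loc.memLp_ball hr

theorem IsH1Loc.memLp_grad {x₀ : Euc n} {δ r : ℝ} {v : Euc n → ℝ}
    {g : Euc n → Euc n} (h : IsH1Loc (ball x₀ δ) v g) (hr : r < δ) :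
    MemLp g 2 (volume.restrict (ball x₀ r)) :=
  h.memL2Loc_grad.memLp_ball hr

theorem IsH1Loc.exists_isSphereTrace [NeZero n] {x₀ : Euc n} {δ r : ℝ} {v : Euc n → ℝ}
    {g : Euc n → Euc n} (h : IsH1Loc (ball x₀ δ) v g) (hr : r ∈ Ioo 0 δ) :
    ∃ T, IsSphereTrace x₀ r v g T := by
  obtain ⟨w, hw⟩ := h.exists_smoothApprox hr.2
  obtain ⟨T, hT, hwT⟩ := hw.exists_tendsto_sphere hr.1 (h.memLp hr.2) (h.memLp_grad hr.2)
  exact ⟨T, hw.isSphereTrace hr.1 (h.memLp hr.2) (h.memLp_grad hr.2) hT hwT⟩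

theorem SmoothApprox.tendsto_trace [NeZero n] {x₀ : Euc n} {r : ℝ} {v : Euc n → ℝ}
    {g : Euc n → Euc n} {w : ℕ → Euc n → ℝ} (h : SmoothApprox x₀ r v g w) (hr : 0 < r)
    (hv : MemLp v 2 (volume.restrict (ball x₀ r)))
    (hg : MemLp g 2 (volume.restrict (ball x₀ r))) {T : Euc n → ℝ}
    (hT : IsSphereTrace x₀ r v g T) :
    Tendsto (fun k => eLpNorm (w k - T) 2 (sphereMeasure x₀ r)) atTop (𝓝 0) := by
  obtain ⟨T', hT', hwT'⟩ := h.exists_tendsto_sphere hr hv hg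
  have hae := (h.isSphereTrace hr hv hg hT' hwT').ae_eq hr hT
  refine hwT'.congr fun k => eLpNorm_congr_ae ?_
  filter_upwards [hae] with x hx
  simp [hx]

/-- The smooth identity passes to the limit since both sides are continuous under L² convergence of
values, gradients and traces. It holds for every radius, as the pointwise definition of the energy
requires. -/
theorem IsH1Loc.mul_integral_trace_sq [NeZero n] {x₀ : Euc n} {δ r : ℝ} {v : Euc n → ℝ}
    {g : Euc n → Euc n} (h : IsH1Loc (ball x₀ δ) v g) (hr : r ∈ Ioo 0 δ) {T : Euc n → ℝ}
    (hT : IsSphereTrace x₀ r v g T) :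
    r * ∫ x, T x ^ 2 ∂(sphereMeasure x₀ r)
      = ∫ x in ball x₀ r, (n * v x ^ 2 + 2 * (v x * inner ℝ (g x) (x - x₀))) := by
  have hv := h.memLp hr.2
  have hg := h.memLp_grad hr.2
  obtain ⟨w, hw⟩ := h.exists_smoothApprox hr.2
  have hwT := hw.tendsto_trace hr.1 hv hg hT
  have hc : ∀ k, ContDiff ℝ 1 (w k) := fun k => (hw.contDiff k).of_le (by simp)
  have ms : ∀ k, MemLp (w k) 2 (sphereMeasure x₀ r) := fun k =>
    memLp_sphere_of_continuous (hc k).continuous x₀ hr.1 2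
  have m1 : ∀ k, MemLp (w k) 2 (volume.restrict (ball x₀ r)) := fun k =>
    memLp_ball_of_continuous (hc k).continuous x₀ r 2
  have hmul : ∀ {a : Euc n → ℝ}, MemLp a 2 (volume.restrict (ball x₀ r)) →
      MemLp (fun x => a x • (x - x₀)) 2 (volume.restrict (ball x₀ r)) := fun {a} ha => by
    refine (ha.norm.const_mul r).mono' (ha.1.smul (by fun_prop)) ?_
    filter_upwards [ae_restrict_mem measurableSet_ball] with x hx
    rw [norm_smul, mul_comm]
    gcongr
    exact (mem_ball_iff_norm.1 hx).le
  have m2 : ∀ k, MemLp (gradient (w k)) 2 (volume.restrict (ball x₀ r)) := fun k =>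
    memLp_ball_of_continuous (continuous_gradient (hc k)) x₀ r 2
  have t0 := tendsto_integral_mul ms ms hT.memLp hT.memLp hwT hwT
  have t1 := tendsto_integral_mul m1 m1 hv hv hw.tendsto hw.tendsto
  have t2 := tendsto_integral_inner m2 (fun k => hmul (m1 k)) hg (hmul hv) hw.tendsto_grad (by
    refine tendsto_of_tendsto_of_tendsto_of_le_of_le tendsto_const_nhds
      (g := fun _ => 0) (h := fun k => ENNReal.ofReal r *
        eLpNorm (w k - v) 2 (volume.restrict (ball x₀ r))) ?_
      (fun _ => zero_le) fun k => ?_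
    · simpa using ENNReal.Tendsto.const_mul (a := ENNReal.ofReal r) hw.tendsto (by simp)
    · refine eLpNorm_le_mul_eLpNorm_of_ae_le_mul ?_ 2
      filter_upwards [ae_restrict_mem measurableSet_ball] with x hx
      simp only [Pi.sub_apply]
      rw [← sub_smul, norm_smul, mul_comm]
      gcongr
      exact (mem_ball_iff_norm.1 hx).le)
  have e : ∀ {a : Euc n → ℝ} {b : Euc n → Euc n}, MemLp a 2 (volume.restrict (ball x₀ r)) →
      MemLp b 2 (volume.restrict (ball x₀ r)) →
      ∫ x in ball x₀ r, (n * a x ^ 2 + 2 * (a x * inner ℝ (b x) (x - x₀))) =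
      n * (∫ x in ball x₀ r, a x * a x) + 2 * ∫ x in ball x₀ r, inner ℝ (b x) (a x • (x - x₀)) := by
    intro a b ha hb
    have i1 : IntegrableOn (fun x => a x * a x) (ball x₀ r) := ha.integrable_mul ha
    have i2 : IntegrableOn (fun x => inner ℝ (b x) (a x • (x - x₀))) (ball x₀ r) :=
      integrable_inner_of_memLp hb (hmul ha)
    rw [← integral_const_mul, ← integral_const_mul, ← integral_add (i1.const_mul _)
      (i2.const_mul _)]
    refine integral_congr_ae (Eventually.of_forall fun x => ?_)
    simp only [real_inner_smul_right]
    ring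
  rw [e hv hg]
  simp only [pow_two]
  refine tendsto_nhds_unique (t0.const_mul r) (((t1.const_mul (n : ℝ)).add
    (t2.const_mul 2)).congr fun k => ?_)
  rw [← e (m1 k) (m2 k), ← mul_integral_sphere_sq x₀ hr.1 (hc k)]
  simp only [pow_two]

theorem ae_Ioo_of_forall_lt {δ : ℝ} {P : ℝ → Prop}
    (h : ∀ R < δ, ∀ᵐ s : ℝ, s ∈ Ioo 0 R → P s) : ∀ᵐ s : ℝ, s ∈ Ioo 0 δ → P s := by
  have h1 : ∀ᵐ s : ℝ, ∀ k : ℕ, s ∈ Ioo 0 (δ - 1 / ((k : ℝ) + 1)) → P s :=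
    ae_all_iff.2 fun k => h _ (by
      have : (0 : ℝ) < 1 / ((k : ℝ) + 1) := by positivity
      linarith)
  filter_upwards [h1] with s hs hsδ
  obtain ⟨k, hk⟩ := exists_nat_one_div_lt (sub_pos.2 hsδ.2)
  exact hs k ⟨hsδ.1, by linarith⟩

/-- Smooth approximations converge to the trace in L² on each sphere and, by Fubini, to `v` almost
everywhere on almost every sphere. Limits in measure are unique. -/
theorem IsH1Loc.ae_trace_eq [NeZero n] {x₀ : Euc n} {δ : ℝ} {v : Euc n → ℝ}
    {g : Euc n → Euc n} (h : IsH1Loc (ball x₀ δ) v g) {T : ℝ → Euc n → ℝ}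
    (hT : ∀ r ∈ Ioo 0 δ, IsSphereTrace x₀ r v g (T r)) :
    ∀ᵐ s : ℝ, s ∈ Ioo 0 δ → T s =ᵐ[sphereMeasure x₀ s] v := by
  refine ae_Ioo_of_forall_lt fun R hR => ?_
  obtain ⟨w, hw⟩ := h.exists_smoothApprox hR
  filter_upwards [ae_ae_sphereMeasure_of_ball x₀ R hw.ae_tendsto] with s hs hsR
  have hsδ : s ∈ Ioo 0 δ := ⟨hsR.1, hsR.2.trans hR⟩
  have hm : ∀ k, AEStronglyMeasurable (w k) (sphereMeasure x₀ s) := fun k =>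
    (hw.contDiff k).continuous.aestronglyMeasurable
  have h1 := tendstoInMeasure_of_tendsto_ae hm (hs hsR)
  have h2 := tendstoInMeasure_of_tendsto_eLpNorm (by simp) hm (hT s hsδ).memLp.1
    ((hw.mono hsR.2.le).tendsto_trace hsR.1 (h.memLp hsδ.2) (h.memLp_grad hsδ.2) (hT s hsδ))
  exact tendstoInMeasure_ae_unique h2 h1

/-! ### The energy identity -/

theorem tendsto_integral_bdd_mul {α : Type*} [MeasurableSpace α] {μ : Measure α} {F : α → ℝ}
    (hF : Integrable F μ) {b : ℕ → α → ℝ} {b₀ : α → ℝ} {C : ℝ}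
    (hb : ∀ k, AEStronglyMeasurable (b k) μ) (hbC : ∀ k x, |b k x| ≤ C)
    (hbt : ∀ᵐ x ∂μ, Tendsto (fun k => b k x) atTop (𝓝 (b₀ x))) :
    Tendsto (fun k => ∫ x, b k x * F x ∂μ) atTop (𝓝 (∫ x, b₀ x * F x ∂μ)) := by
  refine tendsto_integral_of_dominated_convergence (fun x => C * |F x|)
    (fun k => (hb k).mul hF.1) (hF.abs.const_mul C) (fun k => Eventually.of_forall fun x => ?_) ?_
  · rw [Real.norm_eq_abs, abs_mul]
    gcongr
    exact hbC k x
  · filter_upwards [hbt] with x hx using hx.mul_const _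

theorem memLp_bdd_smul {α H : Type*} [MeasurableSpace α] {μ : Measure α}
    [NormedAddCommGroup H] [NormedSpace ℝ H] {g : α → H} (hg : MemLp g 2 μ) {b : α → ℝ} {C : ℝ}
    (hb : AEStronglyMeasurable b μ) (hbC : ∀ᵐ x ∂μ, |b x| ≤ C) :
    MemLp (fun x => b x • g x) 2 μ := by
  refine (hg.norm.const_mul C).mono' (hb.smul hg.1) ?_
  filter_upwards [hbC] with x hx
  rw [norm_smul, Real.norm_eq_abs]
  gcongr

theorem tendsto_eLpNorm_bdd_smul {α H : Type*} [MeasurableSpace α] {μ : Measure α}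
    [NormedAddCommGroup H] [NormedSpace ℝ H] {g : α → H} (hg : MemLp g 2 μ) {b : ℕ → α → ℝ}
    {b₀ : α → ℝ} {C : ℝ}
    (hb : ∀ k, AEStronglyMeasurable (b k) μ) (hbC : ∀ k x, |b k x| ≤ C)
    (hb₀ : AEStronglyMeasurable b₀ μ) (hbC₀ : ∀ x, |b₀ x| ≤ C)
    (hbt : ∀ᵐ x ∂μ, Tendsto (fun k => b k x) atTop (𝓝 (b₀ x))) :
    Tendsto (fun k => eLpNorm ((fun x => b k x • g x) - fun x => b₀ x • g x) 2 μ) atTop (𝓝 0) := by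
  refine tendsto_eLpNorm_two (fun k =>
    (memLp_bdd_smul hg (hb k) (Eventually.of_forall (hbC k))).sub
      (memLp_bdd_smul hg hb₀ (Eventually.of_forall hbC₀))) ?_
  have h := tendsto_integral_bdd_mul (hg.integrable_norm_pow (by simp))
    (b := fun k x => (b k x - b₀ x) ^ 2) (b₀ := fun _ => 0) (C := (C + C) ^ 2)
    (fun k => ((hb k).sub hb₀).pow 2) (fun k x => by
      rw [abs_pow]
      gcongr
      exact (abs_sub _ _).trans (add_le_add (hbC k x) (hbC₀ x))) (by
      filter_upwards [hbt] with x hx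
      simpa using (hx.sub_const (b₀ x)).pow 2)
  simp only [zero_mul, integral_zero] at h
  refine h.congr fun k => integral_congr_ae (Eventually.of_forall fun x => ?_)
  simp only [Pi.sub_apply, ← sub_smul, norm_smul, mul_pow, Real.norm_eq_abs, sq_abs]

/-! ### Weak form of the equation and truncated test functions -/

theorem integrableOn_mul_of_tsupport_subset {Ω : Set (Euc n)} {f ψ : Euc n → ℝ}
    (hf : LocallyIntegrableOn f Ω) (hψ : Continuous ψ) (hψc : HasCompactSupport ψ)
    (hψs : tsupport ψ ⊆ Ω) : IntegrableOn (fun x => f x * ψ x) Ω := by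
  have h1 : IntegrableOn (fun x => f x * ψ x) (tsupport ψ) :=
    (hf.integrableOn_compact_subset hψs hψc).mul_continuousOn hψ.continuousOn hψc
  refine ((integrableOn_iff_integrable_of_support_subset fun x hx => ?_).1 h1).integrableOn
  exact subset_tsupport ψ (right_ne_zero_of_mul hx)

theorem laplacian_eq_sum_fderiv {φ : Euc n → ℝ} (hφ : ContDiff ℝ ∞ φ) (x : Euc n) :
    Laplacian.laplacian φ x = ∑ j, fderiv ℝ (fun y => fderiv ℝ φ y (EuclideanSpace.single j 1)) x
      (EuclideanSpace.single j 1) := by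
  have h := congrFun (InnerProductSpace.laplacian_eq_iteratedFDeriv_orthonormalBasis φ
    (EuclideanSpace.basisFun (Fin n) ℝ)) x
  rw [h]
  refine Finset.sum_congr rfl fun j _ => ?_
  have hd : DifferentiableAt ℝ (fderiv ℝ φ) x :=
    (hφ.fderiv_right (m := ∞) (by simp)).differentiable (by simp) x
  have h2 : HasFDerivAt (fun y => fderiv ℝ φ y (EuclideanSpace.single j 1)) _ x :=
    hd.hasFDerivAt.clm_apply (hasFDerivAt_const (EuclideanSpace.single j (1 : ℝ)) x)
  rw [h2.fderiv, iteratedFDeriv_two_apply]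
  simp

/-- The distributional equation `Δ v + f = 0` in its first order weak form. -/
theorem IsWeakGradient.integral_inner_gradient {Ω : Set (Euc n)} {v f : Euc n → ℝ}
    {g : Euc n → Euc n} (h : IsWeakGradient Ω v g) (hf : LocallyIntegrableOn f Ω)
    (hd : ∀ φ : Euc n → ℝ, ContDiff ℝ ∞ φ → HasCompactSupport φ → tsupport φ ⊆ Ω →
      ∫ x in Ω, (v x * Laplacian.laplacian φ x + f x * φ x) = 0)
    {φ : Euc n → ℝ} (hφ : ContDiff ℝ ∞ φ) (hφc : HasCompactSupport φ) (hφs : tsupport φ ⊆ Ω) :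
    ∫ x in Ω, inner ℝ (g x) (gradient φ x) = ∫ x in Ω, f x * φ x := by
  set e : Fin n → Euc n := fun j => EuclideanSpace.single j 1
  set ψ : Fin n → Euc n → ℝ := fun j y => fderiv ℝ φ y (e j)
  have hψ : ∀ j, ContDiff ℝ ∞ (ψ j) := fun j =>
    (hφ.fderiv_right (m := ∞) (by simp)).clm_apply contDiff_const
  have hψs : ∀ j, tsupport (ψ j) ⊆ tsupport φ := fun j => tsupport_fderiv_apply_subset ℝ (e j)
  have hψc : ∀ j, HasCompactSupport (ψ j) := fun j =>
    hφc.of_isClosed_subset (isClosed_tsupport _) (hψs j)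
  have hψψ : ∀ j, Continuous fun x => fderiv ℝ (ψ j) x (e j) := fun j =>
    ((hψ j).continuous_fderiv (by simp)).clm_apply continuous_const
  have hψψs : ∀ j, tsupport (fun x => fderiv ℝ (ψ j) x (e j)) ⊆ tsupport φ := fun j =>
    (tsupport_fderiv_apply_subset ℝ (e j)).trans (hψs j)
  have i1 : ∀ j, IntegrableOn (fun x => v x * fderiv ℝ (ψ j) x (e j)) Ω := fun j =>
    integrableOn_mul_of_tsupport_subset h.locallyIntegrable (hψψ j)
      (hφc.of_isClosed_subset (isClosed_tsupport _) (hψψs j)) ((hψψs j).trans hφs)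
  have hgj : ∀ j, LocallyIntegrableOn (fun x => inner ℝ (g x) (e j)) Ω := fun j x hx => by
    obtain ⟨U, hU, hgU⟩ := h.locallyIntegrable_grad x hx
    exact ⟨U, hU, hgU.inner_const (e j)⟩
  have i2 : ∀ j, IntegrableOn (fun x => inner ℝ (g x) (e j) * ψ j x) Ω := fun j =>
    integrableOn_mul_of_tsupport_subset (hgj j) (hψ j).continuous (hψc j) ((hψs j).trans hφs)
  have i3 : IntegrableOn (fun x => f x * φ x) Ω :=
    integrableOn_mul_of_tsupport_subset hf hφ.continuous hφc hφs
  have h1 := hd φ hφ hφc hφs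
  have e1 : ∀ x, v x * Laplacian.laplacian φ x = ∑ j, v x * fderiv ℝ (ψ j) x (e j) := fun x => by
    rw [laplacian_eq_sum_fderiv hφ, Finset.mul_sum]
  simp only [e1] at h1
  rw [integral_add (integrable_finsetSum _ fun j _ => i1 j) i3,
    integral_finsetSum _ fun j _ => i1 j] at h1
  have e2 : ∀ x, inner ℝ (g x) (gradient φ x) = ∑ j, inner ℝ (g x) (e j) * ψ j x := fun x => by
    rw [← sum_mul_inner_single]
    refine Finset.sum_congr rfl fun j _ => ?_
    have : ψ j x = inner ℝ (gradient φ x) (e j) := by rw [inner_gradient_left]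
    rw [this]
    congr 1
    simp only [e, EuclideanSpace.inner_single_right]
    simp
  simp only [e2]
  rw [integral_finsetSum _ fun j _ => i2 j]
  -- The weak gradient in direction e_j is tested with ∂_jφ; summing over j reconstructs the
  -- Laplacian.
  have h2 : ∀ j, ∫ x in Ω, v x * fderiv ℝ (ψ j) x (e j) =
      -∫ x in Ω, inner ℝ (g x) (e j) * ψ j x := fun j =>
    h.integral_eq (ψ j) (hψ j) (hψc j) ((hψs j).trans hφs) (e j)
  simp only [h2, Finset.sum_neg_distrib] at h1
  linarith

/-- Since |sinc| ≤ 1, this form lets |v f| dominate the truncated products uniformly in j. -/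
theorem mul_sin_div_eq (j t : ℝ) (hj : 0 < j) : j * Real.sin (t / j) = t * Real.sinc (t / j) := by
  by_cases ht : t = 0
  · simp [ht]
  · rw [Real.sinc_of_ne_zero (div_ne_zero ht hj.ne')]
    field_simp

theorem setIntegral_ball_eq_of_forall_norm {x₀ : Euc n} {r δ : ℝ} (hr : r ≤ δ) {f : Euc n → ℝ}
    (hf : ∀ x, r ≤ ‖x - x₀‖ → f x = 0) : ∫ x in ball x₀ δ, f x = ∫ x in ball x₀ r, f x :=
  setIntegral_eq_of_subset_of_forall_sdiff_eq_zero measurableSet_ball (ball_subset_ball hr)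
    fun x hx => hf x (not_lt.1 (mt mem_ball_iff_norm.2 hx.2))

theorem IsRadialTest.exists_bound {δ : ℝ} {η : ℝ → ℝ} (hη : IsRadialTest δ η) :
    ∃ C, ∀ x₀ x : Euc n, |η ‖x - x₀‖| ≤ C ∧ |deriv η ‖x - x₀‖| ≤ C := by
  obtain ⟨r, h0, hr, hz⟩ := hη.deriv_eq_zero
  obtain ⟨C, hC⟩ := (isCompact_Icc (a := (0 : ℝ)) (b := r)).exists_bound_of_continuousOn
    hη.contDiff.continuous.continuousOn
  obtain ⟨C', hC'⟩ := (isCompact_Icc (a := (0 : ℝ)) (b := r)).exists_bound_of_continuousOn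
    (hη.contDiff.continuous_deriv (by simp)).continuousOn
  have hC0 := (norm_nonneg _).trans (hC 0 ⟨le_rfl, h0.le⟩)
  refine ⟨max C C', fun x₀ x => ?_⟩
  by_cases h : ‖x - x₀‖ ≤ r
  · exact ⟨(hC _ ⟨norm_nonneg _, h⟩).trans (le_max_left _ _),
      (hC' _ ⟨norm_nonneg _, h⟩).trans (le_max_right _ _)⟩
  · have := hz _ (le_of_lt (not_le.1 h))
    simp [this.1, this.2, hC0]

/-- The equation `Δ v + f = 0` tested with the truncation `j sin (v / j)` times a radial
cutoff. -/
theorem IsH1Loc.integral_truncated {x₀ : Euc n} {δ : ℝ} {v f : Euc n → ℝ}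
    {g : Euc n → Euc n} (h : IsH1Loc (ball x₀ δ) v g)
    (hf : LocallyIntegrableOn f (ball x₀ δ))
    (hd : ∀ φ : Euc n → ℝ, ContDiff ℝ ∞ φ → HasCompactSupport φ → tsupport φ ⊆ ball x₀ δ →
      ∫ x in ball x₀ δ, (v x * Laplacian.laplacian φ x + f x * φ x) = 0)
    {η : ℝ → ℝ} (hη : IsRadialTest δ η) {r : ℝ} (hr : r < δ)
    (hz : ∀ s, r ≤ s → η s = 0 ∧ deriv η s = 0) {j : ℝ} (hj : 0 < j) :
    (∫ x in ball x₀ r, Real.cos (v x / j) * (η ‖x - x₀‖ * ‖g x‖ ^ 2)) +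
      (∫ x in ball x₀ r,
        j * Real.sin (v x / j) * (deriv η ‖x - x₀‖ * inner ℝ (g x) (radialDir x₀ x))) =
      ∫ x in ball x₀ r, j * Real.sin (v x / j) * (f x * η ‖x - x₀‖) := by
  obtain ⟨w, hw⟩ := h.exists_smoothApprox hr
  obtain ⟨C, hC⟩ := hη.exists_bound (n := n)
  have hv := h.memLp hr
  have hg := h.memLp_grad hr
  have hcn : Continuous fun x : Euc n => ‖x - x₀‖ := by fun_prop
  have hηc : Continuous fun x : Euc n => η ‖x - x₀‖ := hη.contDiff.continuous.comp hcn
  have hηc' : Continuous fun x : Euc n => deriv η ‖x - x₀‖ :=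
    (hη.contDiff.continuous_deriv (by simp)).comp hcn
  have hc : ∀ k, ContDiff ℝ 1 (w k) := fun k => (hw.contDiff k).of_le (by simp)
  have m2 : ∀ k, MemLp (gradient (w k)) 2 (volume.restrict (ball x₀ r)) := fun k =>
    memLp_ball_of_continuous (continuous_gradient (hc k)) x₀ r 2
  have hfi : IntegrableOn f (ball x₀ r) :=
    (hf.integrableOn_compact_subset (closedBall_subset_ball hr)
      (isCompact_closedBall _ _)).mono_set ball_subset_closedBall
  have hfη : IntegrableOn (fun x => f x * η ‖x - x₀‖) (ball x₀ r) :=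
    hfi.mul_bdd (c := C) hηc.aestronglyMeasurable (Eventually.of_forall fun x => (hC x₀ x).1)
  have hgν : IntegrableOn (fun x => deriv η ‖x - x₀‖ * inner ℝ (g x) (radialDir x₀ x))
      (ball x₀ r) := by
    have hgi : IntegrableOn g (ball x₀ r) := hg.integrable (by norm_num)
    refine (hgi.norm.const_mul C).mono' (hηc'.aestronglyMeasurable.mul
      (hg.1.inner (measurable_radialDir x₀).aestronglyMeasurable))
      (Eventually.of_forall fun x => ?_)
    rw [norm_mul]
    have h1 : ‖inner ℝ (g x) (radialDir x₀ x)‖ ≤ ‖g x‖ :=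
      (norm_inner_le_norm _ _).trans
        (mul_le_of_le_one_right (norm_nonneg _) (norm_radialDir_le x₀ x))
    have h2 := (hC x₀ x).2
    exact mul_le_mul h2 h1 (norm_nonneg _) ((abs_nonneg _).trans h2)
  have hk : ∀ k, (∫ x in ball x₀ r, inner ℝ ((Real.cos (w k x / j) * η ‖x - x₀‖) • g x)
        (gradient (w k) x)) + (∫ x in ball x₀ r,
        j * Real.sin (w k x / j) * (deriv η ‖x - x₀‖ * inner ℝ (g x) (radialDir x₀ x))) =
      ∫ x in ball x₀ r, j * Real.sin (w k x / j) * (f x * η ‖x - x₀‖) := by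
    intro k
    -- The sine is a smooth truncation bounded by j, so this is an admissible test function that
    -- stays bounded as k → ∞.
    set φ : Euc n → ℝ := fun x => (j * Real.sin (w k x / j)) * η ‖x - x₀‖
    have hφ : ContDiff ℝ ∞ φ :=
      (contDiff_const.mul (Real.contDiff_sin.comp ((hw.contDiff k).div_const j))).mul
        (hη.contDiff_radial x₀)
    have hφc : HasCompactSupport φ := (hη.hasCompactSupport x₀).mul_left
    have hφs : tsupport φ ⊆ ball x₀ δ := by
      obtain ⟨r', -, hr', hs⟩ := hη.tsupport_subset x₀
      exact (closure_mono (Function.support_mul_subset_right _ _)).trans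
        (hs.trans (closedBall_subset_ball hr'))
    have hgrad : ∀ x, inner ℝ (g x) (gradient φ x) =
        inner ℝ ((Real.cos (w k x / j) * η ‖x - x₀‖) • g x) (gradient (w k) x) +
        j * Real.sin (w k x / j) * (deriv η ‖x - x₀‖ * inner ℝ (g x) (radialDir x₀ x)) := by
      intro x
      have hdw := ((hc k).differentiable (by simp) x).hasFDerivAt
      have h1 : HasFDerivAt (fun y => w k y / j) (j⁻¹ • fderiv ℝ (w k) x) x := by
        simpa [div_eq_inv_mul] using hdw.const_mul j⁻¹
      have h2 := ((h1.sin.const_mul j).mul (hη.hasFDerivAt_radial x₀ x)).fderiv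
      have h3 : fderiv ℝ φ x = _ := h2
      rw [real_inner_comm, inner_gradient_left, h3, real_inner_smul_left,
        real_inner_comm (gradient (w k) x), inner_gradient_left]
      simp [real_inner_comm]
      field_simp
      ring
    have hmain := h.weakGradient.integral_inner_gradient hf hd hφ hφc hφs
    rw [setIntegral_ball_eq_of_forall_norm hr.le fun x hx => by
        rw [hgrad, (hz _ hx).1, (hz _ hx).2]; simp,
      setIntegral_ball_eq_of_forall_norm hr.le fun x hx => by
        simp only [φ]; rw [(hz _ hx).1]; simp] at hmain
    simp only [hgrad] at hmain
    rw [integral_add] at hmain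
    · rw [hmain]
      refine integral_congr_ae (Eventually.of_forall fun x => ?_)
      simp only [φ]
      ring
    · refine integrable_inner_of_memLp (memLp_bdd_smul (C := C) hg ?_ ?_) (m2 k)
      · have := (hc k).continuous
        exact Continuous.aestronglyMeasurable (Continuous.mul (by fun_prop) hηc)
      · refine Eventually.of_forall fun x => ?_
        rw [abs_mul, ← one_mul C]
        exact mul_le_mul (Real.abs_cos_le_one _) (hC x₀ x).1 (abs_nonneg _) zero_le_one
    · refine hgν.bdd_mul (c := j) ?_ (Eventually.of_forall fun x => ?_)
      · have := (hc k).continuous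
        exact Continuous.aestronglyMeasurable (by fun_prop)
      · rw [norm_mul, Real.norm_of_nonneg hj.le]
        exact mul_le_of_le_one_right hj.le (Real.abs_sin_le_one _)
  have hsin : ∀ t : ℝ, |j * Real.sin (t / j)| ≤ j := fun t => by
    rw [abs_mul, abs_of_pos hj]
    exact mul_le_of_le_one_right hj.le (Real.abs_sin_le_one _)
  have hsinm : ∀ k, AEStronglyMeasurable (fun x => j * Real.sin (w k x / j))
      (volume.restrict (ball x₀ r)) := fun k => by
    have := (hc k).continuous
    exact Continuous.aestronglyMeasurable (by fun_prop)
  have hsint : ∀ᵐ x ∂(volume.restrict (ball x₀ r)),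
      Tendsto (fun k => j * Real.sin (w k x / j)) atTop (𝓝 (j * Real.sin (v x / j))) := by
    filter_upwards [hw.ae_tendsto] with x hx
    exact ((Real.continuous_sin.tendsto _).comp (hx.div_const j)).const_mul j
  have hcosC : ∀ (a : ℝ) (x : Euc n), |Real.cos a * η ‖x - x₀‖| ≤ C := fun a x => by
    rw [abs_mul, ← one_mul C]
    exact mul_le_mul (Real.abs_cos_le_one _) (hC x₀ x).1 (abs_nonneg _) zero_le_one
  have hcosm : ∀ k, AEStronglyMeasurable (fun x => Real.cos (w k x / j) * η ‖x - x₀‖)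
      (volume.restrict (ball x₀ r)) := fun k => by
    have := (hc k).continuous
    exact Continuous.aestronglyMeasurable (Continuous.mul (by fun_prop) hηc)
  have hcosm₀ : AEStronglyMeasurable (fun x => Real.cos (v x / j) * η ‖x - x₀‖)
      (volume.restrict (ball x₀ r)) := by
    refine AEStronglyMeasurable.mul ?_ hηc.aestronglyMeasurable
    exact (Real.continuous_cos.comp (continuous_id.div_const j)).comp_aestronglyMeasurable hv.1
  -- For fixed j the limit k → ∞ is taken. In the gradient term both factors converge in L²; in the
  -- other two the bound |j sin| ≤ j permits dominated convergence, although f is only integrable.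
  have t1 := tendsto_integral_inner (fun k => memLp_bdd_smul hg (hcosm k)
    (Eventually.of_forall fun x => hcosC _ x)) m2 (memLp_bdd_smul hg hcosm₀
    (Eventually.of_forall fun x => hcosC _ x)) hg
    (tendsto_eLpNorm_bdd_smul hg hcosm (fun k x => hcosC _ x) hcosm₀ (fun x => hcosC _ x) (by
      filter_upwards [hw.ae_tendsto] with x hx
      exact ((Real.continuous_cos.tendsto _).comp (hx.div_const j)).mul_const _)) hw.tendsto_grad
  have t2 := tendsto_integral_bdd_mul hgν hsinm (fun k x => hsin _) hsint
  have t3 := tendsto_integral_bdd_mul hfη hsinm (fun k x => hsin _) hsint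
  have hfin := tendsto_nhds_unique ((t1.add t2).congr hk) t3
  rw [← hfin]
  congr 1
  refine integral_congr_ae (Eventually.of_forall fun x => ?_)
  simp only [real_inner_smul_left, real_inner_self_eq_norm_sq]
  ring

theorem integrableOn_ball_of_locallyIntegrableOn {x₀ : Euc n} {δ r : ℝ} {f : Euc n → ℝ}
    (hf : LocallyIntegrableOn f (ball x₀ δ)) (hr : r < δ) : IntegrableOn f (ball x₀ r) :=
  (hf.integrableOn_compact_subset (closedBall_subset_ball hr)
    (isCompact_closedBall _ _)).mono_set ball_subset_closedBall

theorem IsH1Loc.integrableOn_normSq {x₀ : Euc n} {δ r : ℝ} {v : Euc n → ℝ}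
    {g : Euc n → Euc n} (h : IsH1Loc (ball x₀ δ) v g) (hr : r < δ) :
    IntegrableOn (fun x => ‖g x‖ ^ 2) (ball x₀ r) :=
  (h.memLp_grad hr).integrable_norm_pow (by simp)

theorem IsH1Loc.memLp_inner_radialDir {x₀ : Euc n} {δ r : ℝ} {v : Euc n → ℝ}
    {g : Euc n → Euc n} (h : IsH1Loc (ball x₀ δ) v g) (hr : r < δ) :
    MemLp (fun x => inner ℝ (g x) (radialDir x₀ x)) 2 (volume.restrict (ball x₀ r)) :=
  (h.memLp_grad hr).norm.mono'
    ((h.memLp_grad hr).1.inner (measurable_radialDir x₀).aestronglyMeasurable)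
    (Eventually.of_forall fun x => (norm_inner_le_norm _ _).trans
      (mul_le_of_le_one_right (norm_nonneg _) (norm_radialDir_le x₀ x)))

/-- The energy identity `∫_{∂B_s} v ∂_ν v = ∫_{B_s} (|∇v|² - v f)` for solutions of
`Δ v + f = 0`, for almost every radius. -/
theorem IsH1Loc.ae_energy_identity [NeZero n] {x₀ : Euc n} {δ : ℝ} (hδ : 0 < δ)
    {v f : Euc n → ℝ} {g : Euc n → Euc n} (h : IsH1Loc (ball x₀ δ) v g)
    (hf : LocallyIntegrableOn f (ball x₀ δ))
    (hvf : LocallyIntegrableOn (fun x => v x * f x) (ball x₀ δ))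
    (hd : ∀ φ : Euc n → ℝ, ContDiff ℝ ∞ φ → HasCompactSupport φ → tsupport φ ⊆ ball x₀ δ →
      ∫ x in ball x₀ δ, (v x * Laplacian.laplacian φ x + f x * φ x) = 0) :
    ∀ᵐ s : ℝ, s ∈ Ioo 0 δ →
      ∫ x, v x * inner ℝ (g x) (radialDir x₀ x) ∂(sphereMeasure x₀ s) =
        ∫ x in ball x₀ s, (‖g x‖ ^ 2 - v x * f x) := by
  refine ae_integral_sphere_eq_integral_ball x₀ hδ
    (fun r hr => (h.integrableOn_normSq hr).sub (integrableOn_ball_of_locallyIntegrableOn hvf hr))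
    (fun r hr => integrable_mul_of_memLp (h.memLp hr) (h.memLp_inner_radialDir hr))
    fun η hη => ?_
  obtain ⟨r, h0, hr, hz⟩ := hη.deriv_eq_zero
  obtain ⟨C, hC⟩ := hη.exists_bound (n := n)
  have hcn : Continuous fun x : Euc n => ‖x - x₀‖ := by fun_prop
  have hηm : AEStronglyMeasurable (fun x : Euc n => η ‖x - x₀‖) (volume.restrict (ball x₀ r)) :=
    (hη.contDiff.continuous.comp hcn).aestronglyMeasurable
  have hηm' : AEStronglyMeasurable (fun x : Euc n => deriv η ‖x - x₀‖)
      (volume.restrict (ball x₀ r)) :=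
    ((hη.contDiff.continuous_deriv (by simp)).comp hcn).aestronglyMeasurable
  have i1 : IntegrableOn (fun x => η ‖x - x₀‖ * ‖g x‖ ^ 2) (ball x₀ r) :=
    (h.integrableOn_normSq hr).bdd_mul (c := C) hηm (Eventually.of_forall fun x => (hC x₀ x).1)
  have i2 : IntegrableOn
      (fun x => deriv η ‖x - x₀‖ * (v x * inner ℝ (g x) (radialDir x₀ x))) (ball x₀ r) :=
    (integrable_mul_of_memLp (h.memLp hr) (h.memLp_inner_radialDir hr)).bdd_mul (c := C) hηm'
      (Eventually.of_forall fun x => (hC x₀ x).2)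
  have i3 : IntegrableOn (fun x => η ‖x - x₀‖ * (v x * f x)) (ball x₀ r) :=
    (integrableOn_ball_of_locallyIntegrableOn hvf hr).bdd_mul (c := C) hηm
      (Eventually.of_forall fun x => (hC x₀ x).1)
  have hdiv : ∀ t : ℝ, Tendsto (fun k : ℕ => t / ((k : ℝ) + 1)) atTop (𝓝 0) := fun t => by
    simpa [div_eq_mul_inv] using (tendsto_one_div_add_atTop_nhds_zero_nat (𝕜 := ℝ)).const_mul t
  have hvm : ∀ k : ℕ, AEStronglyMeasurable (fun x => v x / ((k : ℝ) + 1))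
      (volume.restrict (ball x₀ r)) := fun k =>
    (continuous_id.div_const _).comp_aestronglyMeasurable (h.memLp hr).1
  have hcos : ∀ᵐ x ∂(volume.restrict (ball x₀ r)),
      Tendsto (fun k : ℕ => Real.cos (v x / ((k : ℝ) + 1))) atTop (𝓝 1) :=
    Eventually.of_forall fun x => by
      simpa [Function.comp_def] using (Real.continuous_cos.tendsto 0).comp (hdiv (v x))
  have hsinc : ∀ᵐ x ∂(volume.restrict (ball x₀ r)),
      Tendsto (fun k : ℕ => Real.sinc (v x / ((k : ℝ) + 1))) atTop (𝓝 1) :=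
    Eventually.of_forall fun x => by
      simpa [Function.comp_def] using (Real.continuous_sinc.tendsto 0).comp (hdiv (v x))
  have hsincm : ∀ k : ℕ, AEStronglyMeasurable (fun x => Real.sinc (v x / ((k : ℝ) + 1)))
      (volume.restrict (ball x₀ r)) := fun k =>
    Real.continuous_sinc.comp_aestronglyMeasurable (hvm k)
  -- The second limit, with j = k + 1 → ∞: cosine and sinc both tend to 1 and are bounded by 1.
  have t1 := tendsto_integral_bdd_mul i1 (b := fun (k : ℕ) x => Real.cos (v x / ((k : ℝ) + 1)))
    (fun k => Real.continuous_cos.comp_aestronglyMeasurable (hvm k))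
    (fun k x => Real.abs_cos_le_one _) hcos
  have t2 := tendsto_integral_bdd_mul i2 hsincm (fun k x => Real.abs_sinc_le_one _) hsinc
  have t3 := tendsto_integral_bdd_mul i3 hsincm (fun k x => Real.abs_sinc_le_one _) hsinc
  simp only [one_mul] at t1 t2 t3
  have hlim := tendsto_nhds_unique ((t1.add t2).congr fun k => ?_) t3
  · rw [setIntegral_ball_eq_of_forall_norm hr.le fun x hx => by
      rw [(hz _ hx).1, (hz _ hx).2]; simp]
    have e : ∀ x, η ‖x - x₀‖ * (‖g x‖ ^ 2 - v x * f x) +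
        deriv η ‖x - x₀‖ * (v x * inner ℝ (g x) (radialDir x₀ x)) =
        (η ‖x - x₀‖ * ‖g x‖ ^ 2 +
          deriv η ‖x - x₀‖ * (v x * inner ℝ (g x) (radialDir x₀ x))) -
        η ‖x - x₀‖ * (v x * f x) := fun x => by ring
    have i12 : IntegrableOn (fun x => η ‖x - x₀‖ * ‖g x‖ ^ 2 +
        deriv η ‖x - x₀‖ * (v x * inner ℝ (g x) (radialDir x₀ x))) (ball x₀ r) := i1.add i2
    simp only [e]
    rw [integral_sub i12 i3, integral_add i1 i2, hlim, sub_self]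
  · have hj : (0 : ℝ) < (k : ℝ) + 1 := by positivity
    have hk := h.integral_truncated hf hd hη hr hz hj
    simp only [mul_sin_div_eq _ _ hj] at hk
    convert hk using 2
    · refine integral_congr_ae (Eventually.of_forall fun x => ?_)
      simp only
      ring
    · ext x
      ring

/-! ### The Pohozaev identity -/

/-- The Pohozaev identity for stationary maps, for almost every radius. -/
theorem ae_pohozaev_identity [NeZero n] {x₀ : Euc n} {δ : ℝ} (hδ : 0 < δ) {G : Euc n → ℝ}
    {Du : Fin m → Euc n → Euc n} (hG : ∀ r < δ, IntegrableOn G (ball x₀ r))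
    (hDu : ∀ i, ∀ r < δ, MemLp (Du i) 2 (volume.restrict (ball x₀ r)))
    (hN : ∀ i, ∀ r < δ,
      IntegrableOn (fun x => inner ℝ (Du i x) (radialDir x₀ x) ^ 2) (ball x₀ r))
    (hst : ∀ φ : Euc n → Euc n, ContDiff ℝ 1 φ → HasCompactSupport φ → tsupport φ ⊆ ball x₀ δ →
      ∫ x in ball x₀ δ, (G x * divergence φ x
        - 2 * ∑ i, inner ℝ (Du i x) (fderiv ℝ φ x (Du i x))) = 0) :
    ∀ᵐ s : ℝ, s ∈ Ioo 0 δ →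
      ∫ x, ‖x - x₀‖ * (G x - 2 * ∑ i, inner ℝ (Du i x) (radialDir x₀ x) ^ 2)
        ∂(sphereMeasure x₀ s) = ∫ x in ball x₀ s, (n * G x - 2 * gradSq Du x) := by
  have hE : ∀ r < δ, IntegrableOn (gradSq Du) (ball x₀ r) := fun r hr =>
    integrable_finsetSum _ fun i _ => (hDu i r hr).integrable_norm_pow (by simp)
  refine ae_integral_sphere_eq_integral_ball x₀ hδ
    (fun r hr => ((hG r hr).const_mul _).sub ((hE r hr).const_mul 2)) (fun r hr => ?_)
    fun η hη => ?_
  · have h1 : IntegrableOn (fun x => G x - 2 * ∑ i, inner ℝ (Du i x) (radialDir x₀ x) ^ 2)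
        (ball x₀ r) :=
      (hG r hr).sub ((integrable_finsetSum _ fun i _ => hN i r hr).const_mul 2)
    refine Integrable.bdd_mul (c := r) h1 (by fun_prop) ?_
    filter_upwards [ae_restrict_mem measurableSet_ball] with x hx
    rw [norm_norm]
    exact (mem_ball_iff_norm.1 hx).le
  · have hid : ContDiff ℝ ∞ fun x : Euc n => x - x₀ := contDiff_id.sub contDiff_const
    have hη1 := hη.contDiff_radial x₀
    -- A radially modulated dilation: its derivative is η times the identity plus η'|x - x₀| times
    -- projection onto the radial direction, the source of the squared normal derivatives.
    have hs := hst (fun x => η ‖x - x₀‖ • (x - x₀)) ((hη1.smul hid).of_le (by simp))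
      (hη.hasCompactSupport x₀).smul_right (by
        obtain ⟨r, -, hr, hsub⟩ := hη.tsupport_subset x₀
        exact (tsupport_smul_subset_left _ _).trans (hsub.trans (closedBall_subset_ball hr)))
    rw [← hs]
    refine integral_congr_ae (Eventually.of_forall fun x => ?_)
    simp only
    have hd1 := hη1.differentiable (by simp) x
    have hd2 := hid.differentiable (by simp) x
    have e1 : divergence (fun x => η ‖x - x₀‖ • (x - x₀)) x =
        η ‖x - x₀‖ * n + deriv η ‖x - x₀‖ * ‖x - x₀‖ := by
      rw [divergence_smul hd1 hd2, divergence_sub_const, (hη.hasFDerivAt_radial x₀ x).fderiv]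
      have h4 : inner ℝ (radialDir x₀ x) (x - x₀) = ‖x - x₀‖ := by
        unfold radialDir sphereNormal
        rw [real_inner_smul_left, real_inner_self_eq_norm_sq]
        by_cases h : ‖x - x₀‖ = 0
        · simp [h]
        · field_simp
      simp [h4]
    have e2 : ∀ i, inner ℝ (Du i x) (fderiv ℝ (fun x => η ‖x - x₀‖ • (x - x₀)) x (Du i x)) =
        η ‖x - x₀‖ * ‖Du i x‖ ^ 2 +
          deriv η ‖x - x₀‖ * (‖x - x₀‖ * inner ℝ (Du i x) (radialDir x₀ x) ^ 2) := fun i => by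
      rw [fderiv_fun_smul hd1 hd2, (hη.hasFDerivAt_radial x₀ x).fderiv]
      have h5 : fderiv ℝ (fun x : Euc n => x - x₀) x = ContinuousLinearMap.id ℝ (Euc n) := by
        simp [fderiv_sub_const]
      rw [h5]
      simp only [_root_.add_apply, _root_.smul_apply, ContinuousLinearMap.id_apply,
        ContinuousLinearMap.smulRight_apply, innerSL_apply_apply, inner_add_right,
        real_inner_smul_right, real_inner_self_eq_norm_sq, smul_eq_mul,
        inner_sub_eq_norm_mul_inner_radialDir x₀ x (Du i x)]
      rw [real_inner_comm (Du i x) (radialDir x₀ x)]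
      ring
    rw [e1]
    simp only [e2, Finset.sum_add_distrib, ← Finset.mul_sum]
    unfold gradSq
    ring

/-! ### Variational solutions -/

section Solution

variable {F : Euc m → ℝ} {x₀ : Euc n} {δ : ℝ} {u : Euc n → Euc m} {Du : Fin m → Euc n → Euc n}

theorem IsVariationalSolution.integrableOn_gradSq (hu : IsVariationalSolution F (ball x₀ δ) u Du)
    {r : ℝ} (hr : r < δ) : IntegrableOn (gradSq Du) (ball x₀ r) :=
  integrable_finsetSum _ fun i _ => (hu.h1Loc i).integrableOn_normSq hr

theorem IsVariationalSolution.integrableOn_F (hu : IsVariationalSolution F (ball x₀ δ) u Du)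
    {r : ℝ} (hr : r < δ) : IntegrableOn (fun x => F (u x)) (ball x₀ r) :=
  integrableOn_ball_of_locallyIntegrableOn hu.locallyIntegrable_F hr

theorem IsVariationalSolution.integrableOn_energy (hu : IsVariationalSolution F (ball x₀ δ) u Du)
    {r : ℝ} (hr : r < δ) : IntegrableOn (fun x => gradSq Du x - 2 * F (u x)) (ball x₀ r) :=
  (hu.integrableOn_gradSq hr).sub ((hu.integrableOn_F hr).const_mul 2)

theorem inner_eq_sum_mul (a b : Euc m) : inner ℝ a b = ∑ i, a i * b i := by
  simp [PiLp.inner_apply, mul_comm]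

theorem IsVariationalSolution.integrableOn_inner (hu : IsVariationalSolution F (ball x₀ δ) u Du)
    {r : ℝ} (hr : r < δ) :
    IntegrableOn (fun x => inner ℝ (u x) (gradient F (u x))) (ball x₀ r) := by
  simp only [inner_eq_sum_mul]
  exact integrable_finsetSum _ fun i _ =>
    integrableOn_ball_of_locallyIntegrableOn (hu.locallyIntegrable_mul_f i) hr

theorem IsVariationalSolution.integrableOn_bulk (hu : IsVariationalSolution F (ball x₀ δ) u Du)
    (β : ℝ) {r : ℝ} (hr : r < δ) :
    IntegrableOn (fun x => 2 * (β - 1) * F (u x) - β * inner ℝ (u x) (gradient F (u x)))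
      (ball x₀ r) :=
  ((hu.integrableOn_F hr).const_mul _).sub ((hu.integrableOn_inner hr).const_mul _)

theorem IsVariationalSolution.bulkTerm_eq (hu : IsVariationalSolution F (ball x₀ δ) u Du)
    (β : ℝ) {r : ℝ} (hr : r < δ) :
    bulkTerm F β x₀ u r = 2 * (β - 1) * (∫ x in ball x₀ r, F (u x)) -
      β * ∫ x in ball x₀ r, inner ℝ (u x) (gradient F (u x)) := by
  unfold bulkTerm
  rw [integral_sub ((hu.integrableOn_F hr).const_mul _) ((hu.integrableOn_inner hr).const_mul _),
    integral_const_mul, integral_const_mul]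

/-- The integrand whose integral over `B_r` is `r ∫_{∂B_r} |u|²`. -/
noncomputable def traceDensity (x₀ : Euc n) (u : Euc n → Euc m) (Du : Fin m → Euc n → Euc n)
    (x : Euc n) : ℝ :=
  ∑ i, (n * u x i ^ 2 + 2 * (u x i * inner ℝ (Du i x) (x - x₀)))

theorem IsVariationalSolution.integrableOn_traceDensity_apply
    (hu : IsVariationalSolution F (ball x₀ δ) u Du) {r : ℝ} (hr : r < δ) (i : Fin m) :
    IntegrableOn (fun x => n * u x i ^ 2 + 2 * (u x i * inner ℝ (Du i x) (x - x₀)))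
      (ball x₀ r) := by
  have hv := (hu.h1Loc i).memLp hr
  have h1 : IntegrableOn (fun x => ‖x - x₀‖ * (u x i * inner ℝ (Du i x) (radialDir x₀ x)))
      (ball x₀ r) := by
    refine (integrable_mul_of_memLp hv ((hu.h1Loc i).memLp_inner_radialDir hr)).bdd_mul (c := r)
      (by fun_prop) ?_
    filter_upwards [ae_restrict_mem measurableSet_ball] with x hx
    rw [norm_norm]
    exact (mem_ball_iff_norm.1 hx).le
  refine ((hv.integrable_sq.const_mul (n : ℝ)).add (h1.const_mul 2)).congr
    (Eventually.of_forall fun x => ?_)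
  simp only [Pi.add_apply, inner_sub_eq_norm_mul_inner_radialDir x₀ x]
  ring

theorem IsVariationalSolution.integrableOn_traceDensity
    (hu : IsVariationalSolution F (ball x₀ δ) u Du) {r : ℝ} (hr : r < δ) :
    IntegrableOn (traceDensity x₀ u Du) (ball x₀ r) :=
  integrable_finsetSum _ fun i _ => hu.integrableOn_traceDensity_apply hr i

theorem norm_sq_eq_sum (a : Euc m) : ‖a‖ ^ 2 = ∑ i, a i ^ 2 := by
  rw [EuclideanSpace.norm_sq_eq]
  simp

theorem IsVariationalSolution.mul_integral_norm_trace_sq [NeZero n]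
    (hu : IsVariationalSolution F (ball x₀ δ) u Du) {r : ℝ} (hr : r ∈ Ioo 0 δ)
    {T : Euc n → Euc m}
    (hT : ∀ i, IsSphereTrace x₀ r (fun x => u x i) (Du i) (fun x => T x i)) :
    r * ∫ x, ‖T x‖ ^ 2 ∂(sphereMeasure x₀ r) = ∫ x in ball x₀ r, traceDensity x₀ u Du x := by
  simp only [norm_sq_eq_sum, traceDensity]
  rw [integral_finsetSum _ fun i _ => (hT i).memLp.integrable_sq,
    integral_finsetSum _ fun i _ => hu.integrableOn_traceDensity_apply hr.2 i, Finset.mul_sum]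
  exact Finset.sum_congr rfl fun i _ => (hu.h1Loc i).mul_integral_trace_sq hr (hT i)

theorem ae_integrable_sphere [NeZero n] {g : Euc n → ℝ}
    (hg : ∀ r < δ, IntegrableOn g (ball x₀ r)) :
    ∀ᵐ s : ℝ, s ∈ Ioo 0 δ → Integrable g (sphereMeasure x₀ s) :=
  ae_Ioo_of_forall_lt fun R hR => (integrable_polar_ball x₀ (hg R hR)).1

/-- The identities on almost every sphere that enter the monotonicity formula. -/
theorem IsVariationalSolution.ae_sphere_identities [NeZero n] (hδ : 0 < δ)
    (hu : IsVariationalSolution F (ball x₀ δ) u Du) (β : ℝ) {T : ℝ → Euc n → Euc m}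
    (hT : ∀ r ∈ Ioo 0 δ, ∀ i, IsSphereTrace x₀ r (fun x => u x i) (Du i) (fun x => T r x i)) :
    ∀ᵐ s : ℝ, s ∈ Ioo 0 δ →
      Integrable (boundaryIntegrand β x₀ Du (T s) s) (sphereMeasure x₀ s) ∧
      ∃ N q U : ℝ,
        s * ((∫ x, (gradSq Du x - 2 * F (u x)) ∂(sphereMeasure x₀ s)) - 2 * N) =
          n * (∫ x in ball x₀ s, (gradSq Du x - 2 * F (u x))) -
            2 * ∫ x in ball x₀ s, gradSq Du x ∧
        q = (∫ x in ball x₀ s, gradSq Du x) -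
          (∫ x in ball x₀ s, inner ℝ (u x) (gradient F (u x))) ∧
        U = ∫ x, ‖T s x‖ ^ 2 ∂(sphereMeasure x₀ s) ∧
        ∫ x, traceDensity x₀ u Du x ∂(sphereMeasure x₀ s) = n * U + 2 * (s * q) ∧
        ∫ x, boundaryIntegrand β x₀ Du (T s) s x ∂(sphereMeasure x₀ s) =
          N - 2 * (β / s) * q + (β / s) ^ 2 * U := by
  have iN : ∀ i, ∀ r < δ, IntegrableOn (fun x => inner ℝ (Du i x) (radialDir x₀ x) ^ 2)
      (ball x₀ r) := fun i r hr => ((hu.h1Loc i).memLp_inner_radialDir hr).integrable_sq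
  have iq : ∀ i, ∀ r < δ, IntegrableOn (fun x => u x i * inner ℝ (Du i x) (radialDir x₀ x))
      (ball x₀ r) := fun i r hr =>
    integrable_mul_of_memLp ((hu.h1Loc i).memLp hr) ((hu.h1Loc i).memLp_inner_radialDir hr)
  have iU : ∀ i, ∀ r < δ, IntegrableOn (fun x => u x i ^ 2) (ball x₀ r) := fun i r hr =>
    ((hu.h1Loc i).memLp hr).integrable_sq
  have aN := ae_all_iff.2 fun i => ae_integrable_sphere (iN i)
  have aq := ae_all_iff.2 fun i => ae_integrable_sphere (iq i)
  have aU := ae_all_iff.2 fun i => ae_integrable_sphere (iU i)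
  have aG := ae_integrable_sphere (g := fun x => gradSq Du x - 2 * F (u x)) (x₀ := x₀)
    fun r hr => hu.integrableOn_energy hr
  have aT := ae_all_iff.2 fun i => (hu.h1Loc i).ae_trace_eq fun r hr => hT r hr i
  have aE := ae_all_iff.2 fun i => (hu.h1Loc i).ae_energy_identity hδ (hu.locallyIntegrable_f i)
    (hu.locallyIntegrable_mul_f i) (hu.distributional i)
  have aP := ae_pohozaev_identity hδ (G := fun x => gradSq Du x - 2 * F (u x))
    (fun r hr => hu.integrableOn_energy hr) (fun i r hr => (hu.h1Loc i).memLp_grad hr) iN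
    hu.stationary
  filter_upwards [aN, aq, aU, aG, aT, aE, aP] with s aN aq aU aG aT aE aP hs
  have aN := fun i => aN i hs
  have aq := fun i => aq i hs
  have aU := fun i => aU i hs
  have hsN : Integrable (fun x => ∑ i, inner ℝ (Du i x) (radialDir x₀ x) ^ 2)
      (sphereMeasure x₀ s) := integrable_finsetSum _ fun i _ => aN i
  have hsq : Integrable (fun x => ∑ i, u x i * inner ℝ (Du i x) (radialDir x₀ x))
      (sphereMeasure x₀ s) := integrable_finsetSum _ fun i _ => aq i
  have hsU : Integrable (fun x => ∑ i, u x i ^ 2) (sphereMeasure x₀ s) :=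
    integrable_finsetSum _ fun i _ => aU i
  have hTu : ∀ᵐ x ∂(sphereMeasure x₀ s), ∀ i, T s x i = u x i := ae_all_iff.2 fun i => aT i hs
  have hbd : boundaryIntegrand β x₀ Du (T s) s =ᵐ[sphereMeasure x₀ s] fun x =>
      (∑ i, inner ℝ (Du i x) (radialDir x₀ x) ^ 2) -
        2 * (β / s) * (∑ i, u x i * inner ℝ (Du i x) (radialDir x₀ x)) +
        (β / s) ^ 2 * ∑ i, u x i ^ 2 := by
    filter_upwards [hTu, ae_norm_sub_eq x₀ hs.1] with x hx hxs
    simp only [boundaryIntegrand, hx, ← radialDir_eq x₀ hxs]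
    rw [Finset.mul_sum, Finset.mul_sum, ← Finset.sum_sub_distrib, ← Finset.sum_add_distrib]
    exact Finset.sum_congr rfl fun i _ => by ring
  have h12 : Integrable (fun x => (∑ i, inner ℝ (Du i x) (radialDir x₀ x) ^ 2) -
      2 * (β / s) * (∑ i, u x i * inner ℝ (Du i x) (radialDir x₀ x))) (sphereMeasure x₀ s) :=
    hsN.sub (hsq.const_mul _)
  -- The witnesses N, q, U are the integrals of |∂_ν u|², u·∂_ν u and |u|² over the sphere;
  -- expanding the square gives the last identity.
  refine ⟨(h12.add (hsU.const_mul _)).congr hbd.symm,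
    ∫ x, ∑ i, inner ℝ (Du i x) (radialDir x₀ x) ^ 2 ∂(sphereMeasure x₀ s),
    ∫ x, ∑ i, u x i * inner ℝ (Du i x) (radialDir x₀ x) ∂(sphereMeasure x₀ s),
    ∫ x, ∑ i, u x i ^ 2 ∂(sphereMeasure x₀ s), ?_, ?_, ?_, ?_, ?_⟩
  · have h := aP hs
    rw [integral_sub ((hu.integrableOn_energy hs.2).const_mul _)
      ((hu.integrableOn_gradSq hs.2).const_mul _), integral_const_mul, integral_const_mul] at h
    rw [← h, ← integral_const_mul, ← integral_sub (aG hs) (hsN.const_mul 2), ← integral_const_mul]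
    exact integral_sphereMeasure_congr x₀ hs.1 fun x hx => by rw [hx]
  · rw [integral_finsetSum _ fun i _ => aq i, ← integral_sub (hu.integrableOn_gradSq hs.2)
      (hu.integrableOn_inner hs.2)]
    have iE : ∀ i, IntegrableOn (fun x => ‖Du i x‖ ^ 2 - u x i * gradient F (u x) i)
        (ball x₀ s) := fun i => ((hu.h1Loc i).integrableOn_normSq hs.2).sub
      (integrableOn_ball_of_locallyIntegrableOn (hu.locallyIntegrable_mul_f i) hs.2)
    have e : ∀ x, gradSq Du x - inner ℝ (u x) (gradient F (u x)) =
        ∑ i, (‖Du i x‖ ^ 2 - u x i * gradient F (u x) i) := fun x => by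
      rw [inner_eq_sum_mul, gradSq, ← Finset.sum_sub_distrib]
    simp only [e]
    rw [integral_finsetSum _ fun i _ => iE i]
    exact Finset.sum_congr rfl fun i _ => aE i hs
  · refine integral_congr_ae ?_
    filter_upwards [hTu] with x hx
    simp only [norm_sq_eq_sum, hx]
  · rw [← integral_const_mul, ← integral_const_mul, ← integral_const_mul,
      ← integral_add (hsU.const_mul _) ((hsq.const_mul _).const_mul _)]
    refine integral_sphereMeasure_congr x₀ hs.1 fun x hx => ?_
    simp only [traceDensity, inner_sub_eq_norm_mul_inner_radialDir x₀ x, hx]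
    rw [Finset.mul_sum, Finset.mul_sum, Finset.mul_sum, ← Finset.sum_add_distrib]
    exact Finset.sum_congr rfl fun i _ => by ring
  · rw [integral_congr_ae hbd, integral_add h12 (hsU.const_mul _), integral_sub hsN
      (hsq.const_mul _), integral_const_mul, integral_const_mul]

/-! ### Differentiation of the energy -/

/-- Integration by parts of a power against `r ↦ ∫_{B_r} g`. -/
theorem rpow_mul_integral_ball_sub [NeZero n] {g : Euc n → ℝ} {σ ρ : ℝ} (hρ : 0 < ρ)
    (hρσ : ρ ≤ σ) (hg : IntegrableOn g (ball x₀ σ)) (p : ℝ) :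
    IntervalIntegrable (fun t => p * t ^ (p - 1) * (∫ x in ball x₀ t, g x) +
      t ^ p * ∫ x, g x ∂(sphereMeasure x₀ t)) volume ρ σ ∧
    ∫ t in ρ..σ, (p * t ^ (p - 1) * (∫ x in ball x₀ t, g x) +
      t ^ p * ∫ x, g x ∂(sphereMeasure x₀ t)) =
    σ ^ p * (∫ x in ball x₀ σ, g x) - ρ ^ p * ∫ x in ball x₀ ρ, g x := by
  have hσ : 0 ≤ σ := hρ.le.trans hρσ
  have hsub : uIcc ρ σ ⊆ Icc 0 σ := by
    rw [uIcc_of_le hρσ]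
    exact Icc_subset_Icc_left hρ.le
  have hne : ∀ t ∈ Icc ρ σ, t ≠ 0 := fun t ht => (hρ.trans_le ht.1).ne'
  have hcont : ∀ q : ℝ, ContinuousOn (fun t : ℝ => t ^ q) (uIcc ρ σ) := fun q t ht =>
    (Real.continuousAt_rpow_const t q (Or.inl (hne t (by rwa [uIcc_of_le hρσ] at ht))))
      |>.continuousWithinAt
  have ha := intervalIntegrable_sphere x₀ hg hρ.le hρσ le_rfl
  refine ⟨?_, integral_deriv_mul_add_mul_eq_sub hρσ ha (fun t ht => ?_) (fun t ht => ?_)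
    fun t ht => Real.hasDerivAt_rpow_const (Or.inl (hne t ht))⟩
  · refine IntervalIntegrable.add (ContinuousOn.intervalIntegrable ?_)
      (ha.continuousOn_mul (hcont p))
    exact (continuousOn_const.mul (hcont _)).mul
      ((continuousOn_integral_ball x₀ hσ hg).mono hsub)
  · rw [integral_ball_eq_intervalIntegral x₀ hg (hρ.le.trans ht.1) ht.2,
      integral_ball_eq_intervalIntegral x₀ hg hρ.le hρσ, sub_eq_iff_eq_add, add_comm]
    exact (intervalIntegral.integral_add_adjacent_intervals
      (intervalIntegrable_sphere x₀ hg le_rfl hρ.le hρσ)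
      (intervalIntegrable_sphere x₀ hg hρ.le ht.1 ht.2)).symm
  · exact (Real.contDiffAt_rpow_const_of_ne (hne t ht)).contDiffWithinAt

/-- Trading the trace integral for a volume integral, at the cost of one power of r, avoids
differentiating traces with respect to the radius. -/
theorem IsVariationalSolution.energy_eq [NeZero n]
    (hu : IsVariationalSolution F (ball x₀ δ) u Du) (β : ℝ) {T : ℝ → Euc n → Euc m}
    (hT : ∀ r ∈ Ioo 0 δ, ∀ i, IsSphereTrace x₀ r (fun x => u x i) (Du i) (fun x => T r x i))
    {r : ℝ} (hr : r ∈ Ioo 0 δ) :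
    boundaryAdjustedEnergy F β x₀ u Du T r =
      r ^ (-(n : ℝ) - 2 * β + 2) * (∫ x in ball x₀ r, (gradSq Du x - 2 * F (u x))) -
        β * (r ^ (-(n : ℝ) - 2 * β) * ∫ x in ball x₀ r, traceDensity x₀ u Du x) := by
  rw [← hu.mul_integral_norm_trace_sq hr (hT r hr), boundaryAdjustedEnergy,
    Real.rpow_add_one hr.1.ne']
  ring

/-- The monotonicity formula. -/
theorem IsVariationalSolution.monotonicity_formula [NeZero n]
    (hu : IsVariationalSolution F (ball x₀ δ) u Du) (β : ℝ) {T : ℝ → Euc n → Euc m}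
    (hT : ∀ r ∈ Ioo 0 δ, ∀ i, IsSphereTrace x₀ r (fun x => u x i) (Du i) (fun x => T r x i))
    {ρ σ : ℝ} (hρ : 0 < ρ) (hρσ : ρ < σ) (hσ : σ < δ) :
    IntervalIntegrable
      (fun r => 2 * r ^ (-(n : ℝ) - 2 * β + 1) * bulkTerm F β x₀ u r) volume ρ σ ∧
    IntervalIntegrable
      (fun r => 2 * r ^ (-(n : ℝ) - 2 * β + 2)
        * ∫ x, boundaryIntegrand β x₀ Du (T r) r x ∂(sphereMeasure x₀ r)) volume ρ σ ∧
    boundaryAdjustedEnergy F β x₀ u Du T σ - boundaryAdjustedEnergy F β x₀ u Du T ρ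
      = (∫ r in ρ..σ, 2 * r ^ (-(n : ℝ) - 2 * β + 1) * bulkTerm F β x₀ u r)
        + (∫ r in ρ..σ, 2 * r ^ (-(n : ℝ) - 2 * β + 2)
            * ∫ x, boundaryIntegrand β x₀ Du (T r) r x ∂(sphereMeasure x₀ r)) := by
  have hδ : 0 < δ := hρ.trans (hρσ.trans hσ)
  obtain ⟨iD, eD⟩ := rpow_mul_integral_ball_sub hρ hρσ.le (hu.integrableOn_energy hσ)
    (-(n : ℝ) - 2 * β + 2)
  obtain ⟨iK, eK⟩ := rpow_mul_integral_ball_sub hρ hρσ.le (hu.integrableOn_traceDensity hσ)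
    (-(n : ℝ) - 2 * β)
  have i1 : IntervalIntegrable
      (fun r => 2 * r ^ (-(n : ℝ) - 2 * β + 1) * bulkTerm F β x₀ u r) volume ρ σ := by
    refine ContinuousOn.intervalIntegrable ?_
    rw [uIcc_of_le hρσ.le]
    refine (continuousOn_const.mul fun t ht => ?_).mul
      ((continuousOn_integral_ball x₀ (hρ.trans hρσ).le (hu.integrableOn_bulk β hσ)).mono
        (Icc_subset_Icc_left hρ.le))
    exact (Real.continuousAt_rpow_const t _
      (Or.inl (hρ.trans_le ht.1).ne')).continuousWithinAt
  -- The pointwise form of the theorem: Φ' minus the weighted bulk term is the weighted square.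
  have hae : ∀ᵐ t : ℝ, t ∈ uIoc ρ σ →
      ((-(n : ℝ) - 2 * β + 2) * t ^ (-(n : ℝ) - 2 * β + 2 - 1) *
          (∫ x in ball x₀ t, (gradSq Du x - 2 * F (u x))) + t ^ (-(n : ℝ) - 2 * β + 2) *
          ∫ x, (gradSq Du x - 2 * F (u x)) ∂(sphereMeasure x₀ t)) -
        β * ((-(n : ℝ) - 2 * β) * t ^ (-(n : ℝ) - 2 * β - 1) *
          (∫ x in ball x₀ t, traceDensity x₀ u Du x) + t ^ (-(n : ℝ) - 2 * β) *
          ∫ x, traceDensity x₀ u Du x ∂(sphereMeasure x₀ t)) -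
        2 * t ^ (-(n : ℝ) - 2 * β + 1) * bulkTerm F β x₀ u t =
      2 * t ^ (-(n : ℝ) - 2 * β + 2)
        * ∫ x, boundaryIntegrand β x₀ Du (T t) t x ∂(sphereMeasure x₀ t) := by
    filter_upwards [hu.ae_sphere_identities hδ β hT] with t ht htm
    rw [uIoc_of_le hρσ.le] at htm
    have h0 : 0 < t := hρ.trans htm.1
    have hts : t ∈ Ioo 0 δ := ⟨h0, htm.2.trans_lt hσ⟩
    obtain ⟨-, N, q, U, hP, hq, hU, hk, hb⟩ := ht hts
    have hK := hu.mul_integral_norm_trace_sq hts (hT t hts)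
    have hD : ∫ x in ball x₀ t, (gradSq Du x - 2 * F (u x)) =
        (∫ x in ball x₀ t, gradSq Du x) - 2 * ∫ x in ball x₀ t, F (u x) := by
      rw [integral_sub (hu.integrableOn_gradSq hts.2) ((hu.integrableOn_F hts.2).const_mul 2),
        integral_const_mul]
    rw [hb, hk, ← hK, ← hU, hu.bulkTerm_eq β hts.2]
    have e1 : t ^ (-(n : ℝ) - 2 * β + 2 - 1) = t ^ (-(n : ℝ) - 2 * β) * t := by
      rw [← Real.rpow_add_one h0.ne']
      ring_nf
    have e2 : t ^ (-(n : ℝ) - 2 * β + 2) = t ^ (-(n : ℝ) - 2 * β) * t ^ 2 := by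
      rw [Real.rpow_add h0]
      norm_num
    rw [e1, e2, Real.rpow_add_one h0.ne', Real.rpow_sub_one h0.ne']
    -- With every power of t reduced to X and every integral to a variable, only an algebraic
    -- identity remains.
    generalize t ^ (-(n : ℝ) - 2 * β) = X at *
    generalize ∫ x, (gradSq Du x - 2 * F (u x)) ∂(sphereMeasure x₀ t) = A at *
    rw [hD] at hP ⊢
    generalize (∫ x in ball x₀ t, gradSq Du x) = E at *
    generalize (∫ x in ball x₀ t, F (u x)) = Φ at *
    generalize (∫ x in ball x₀ t, inner ℝ (u x) (gradient F (u x))) = P at *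
    have e3 : X / t * (t * U) = X * U := by field_simp
    have e4 : t ^ 2 * (N - 2 * (β / t) * q + (β / t) ^ 2 * U) =
        t ^ 2 * N - 2 * β * t * q + β ^ 2 * U := by field_simp
    -- `hP` is the Pohozaev identity and `hq` the energy identity; `e3` and `e4` clear the
    -- denominators in the trace term and in the expanded square.
    linear_combination X * t * hP + β * (n + 2 * β) * e3 - 2 * X * e4 + 2 * β * X * t * hq
  -- The boundary term inherits integrability in r from the other terms, with which it agrees almost
  -- everywhere.
  have hi : IntervalIntegrable
      (fun r => 2 * r ^ (-(n : ℝ) - 2 * β + 2)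
        * ∫ x, boundaryIntegrand β x₀ Du (T r) r x ∂(sphereMeasure x₀ r)) volume ρ σ :=
    ((iD.sub (iK.const_mul β)).sub i1).congr_ae
      ((ae_restrict_iff' measurableSet_uIoc).2 hae)
  refine ⟨i1, hi, ?_⟩
  rw [← intervalIntegral.integral_congr_ae hae, intervalIntegral.integral_sub
    (iD.sub (iK.const_mul β)) i1, intervalIntegral.integral_sub iD (iK.const_mul β),
    intervalIntegral.integral_const_mul, eD, eK, hu.energy_eq β hT ⟨hρ.trans hρσ, hσ⟩,
    hu.energy_eq β hT ⟨hρ, hρσ.trans hσ⟩]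
  ring

end Solution

end BoundaryAdjustedEnergy

/-! ### The theorem -/

theorem theorem2p1 {n m : ℕ} (hn : 0 < n)
    (F : Euc m → ℝ) (hF : ContDiff ℝ ∞ F)
    (x₀ : Euc n) (δ : ℝ) (hδ : 0 < δ)
    (u : Euc n → Euc m) (Du : Fin m → Euc n → Euc n)
    (hu : IsVariationalSolution F (ball x₀ δ) u Du)
    (β : ℝ) (hβ : ∀ r : ℝ, 0 < r → r < δ → 0 ≤ bulkTerm F β x₀ u r) :
    -- `u` has boundary values (traces) on every sphere inside the ball
    (∀ r ∈ Ioo 0 δ, ∃ T : Euc n → Euc m,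
      ∀ i, IsSphereTrace x₀ r (fun x => u x i) (Du i) (fun x => T x i)) ∧
    -- and, whichever representatives `T r` of these boundary values are used:
    (∀ T : ℝ → Euc n → Euc m,
      (∀ r ∈ Ioo 0 δ, ∀ i, IsSphereTrace x₀ r (fun x => u x i) (Du i) (fun x => T r x i)) →
      -- all volume integrals exist
      (∀ r ∈ Ioo 0 δ,
        IntegrableOn (fun x => gradSq Du x - 2 * F (u x)) (ball x₀ r) ∧
        IntegrableOn (fun x => 2 * (β - 1) * F (u x) - β * inner ℝ (u x) (gradient F (u x)))
          (ball x₀ r)) ∧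
      -- the boundary integrals in the monotonicity formula exist for almost every radius
      (∀ᵐ r : ℝ, r ∈ Ioo 0 δ →
        Integrable (boundaryIntegrand β x₀ Du (T r) r) (sphereMeasure x₀ r)) ∧
      -- the monotonicity formula
      (∀ ρ σ : ℝ, 0 < ρ → ρ < σ → σ < δ →
        IntervalIntegrable
          (fun r => 2 * r ^ (-(n : ℝ) - 2 * β + 1) * bulkTerm F β x₀ u r) volume ρ σ ∧
        IntervalIntegrable
          (fun r => 2 * r ^ (-(n : ℝ) - 2 * β + 2)
            * ∫ x, boundaryIntegrand β x₀ Du (T r) r x ∂(sphereMeasure x₀ r)) volume ρ σ ∧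
        boundaryAdjustedEnergy F β x₀ u Du T σ - boundaryAdjustedEnergy F β x₀ u Du T ρ
          = (∫ r in ρ..σ, 2 * r ^ (-(n : ℝ) - 2 * β + 1) * bulkTerm F β x₀ u r)
            + (∫ r in ρ..σ, 2 * r ^ (-(n : ℝ) - 2 * β + 2)
                * ∫ x, boundaryIntegrand β x₀ Du (T r) r x ∂(sphereMeasure x₀ r)) ∧
        0 ≤ boundaryAdjustedEnergy F β x₀ u Du T σ - boundaryAdjustedEnergy F β x₀ u Du T ρ) ∧
      -- in particular the energy is nondecreasing
      MonotoneOn (boundaryAdjustedEnergy F β x₀ u Du T) (Ioo 0 δ)) := by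
  have : NeZero n := ⟨hn.ne'⟩
  refine ⟨fun r hr => ?_, fun T hT => ?_⟩
  · choose T hT using fun i => (hu.h1Loc i).exists_isSphereTrace hr
    exact ⟨fun x => WithLp.toLp 2 fun i => T i x, hT⟩
  have hformula : ∀ ρ σ : ℝ, 0 < ρ → ρ < σ → σ < δ → _ := fun ρ σ hρ hρσ hσ =>
    hu.monotonicity_formula β hT hρ hρσ hσ
  have hnonneg : ∀ ρ σ : ℝ, 0 < ρ → ρ < σ → σ < δ →
      0 ≤ boundaryAdjustedEnergy F β x₀ u Du T σ - boundaryAdjustedEnergy F β x₀ u Du T ρ := by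
    intro ρ σ hρ hρσ hσ
    rw [(hformula ρ σ hρ hρσ hσ).2.2]
    refine add_nonneg (intervalIntegral.integral_nonneg hρσ.le fun t ht => ?_)
      (intervalIntegral.integral_nonneg hρσ.le fun t ht => ?_)
    -- The sign condition on the bulk term enters here; the other summand is an integral of squares.
    · have h0 : 0 < t := hρ.trans_le ht.1
      have := hβ t h0 (ht.2.trans_lt hσ)
      positivity
    · have h0 : 0 < t := hρ.trans_le ht.1
      refine mul_nonneg (by positivity) (integral_nonneg fun x => ?_)
      exact Finset.sum_nonneg fun i _ => sq_nonneg _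
  refine ⟨fun r hr => ⟨hu.integrableOn_energy hr.2, hu.integrableOn_bulk β hr.2⟩, ?_,
    fun ρ σ hρ hρσ hσ => ?_, fun ρ hρ σ hσ hle => ?_⟩
  · filter_upwards [hu.ae_sphere_identities hδ β hT] with r h hr using (h hr).1
  · obtain ⟨h1, h2, h3⟩ := hformula ρ σ hρ hρσ hσ
    exact ⟨h1, h2, h3, hnonneg ρ σ hρ hρσ hσ⟩
  · rcases hle.eq_or_lt with rfl | hlt
    · exact le_rfl
    · exact sub_nonneg.1 (hnonneg ρ σ hρ.1 hlt hσ.2)
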